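/- \textbf{Theorem (Two-sender quantum simultaneous decoding).} Let $\mathcal X_1,\mathcal X_2$ be finite alphabets, $\mathcal H^B$ a finite-dimensional complex Hilbert space, and let $(x_1,x_2)\mapsto\rho_{x_1,x_2}$ be a two-sender classical-quantum multiple access channel, i.e. an assignment of a density operator on $\mathcal H^B$ to every $(x_1,x_2)\in\mathcal X_1\times\mathcal X_2$. Let $p_{X_1},p_{X_2}$ be probability distributions on $\mathcal X_1,\mathcal X_2$ and let $$\theta^{X_1X_2B}=\sum_{x_1,x_2}p_{X_1}(x_1)p_{X_2}(x_2)\,|x_1\rangle\langle x_1|\otimes|x_2\rangle\langle x_2|\otimes\rho_{x_1,x_2}.$$ Put $H(\sigma)=-\mathrm{Tr}(\sigma\log_2\sigma)$, $I(A;B)=H(A)+H(B)-H(AB)$ and $I(A;B|C)=H(AC)+H(BC)-H(ABC)-H(C)$, the entropies being those of the reduced states of $\theta$. \emph{Typical projectors.} For a finite ensemble $\{p(x),\sigma_x\}$ of density operators on $\mathcal H^B$ with spectral decompositions $\sigma_x=\sum_y\lambda_x(y)|e_{x,y}\rangle\langle e_{x,y}|$, for $\eta>0$ and $x^n=(x_1,\dots,x_n)$,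 the conditionally typical projector $\Pi^n_{\sigma_{x^n},\eta}$ is the projector onto the span of those vectors $|e_{x_1,y_1}\rangle\otimes\cdots\otimes|e_{x_n,y_n}\rangle$ for which $\prod_i\lambda_{x_i}(y_i)>0$ and $\bigl|-\tfrac1n\log_2\prod_i\lambda_{x_i}(y_i)-\sum_xp(x)H(\sigma_x)\bigr|\le\eta$. For a single state $\sigma$ this is the typical projector $\Pi^n_{\sigma,\eta}$. \emph{Decoder.} Let $\bar\rho_{x_1}=\sum_{x_2}p_{X_2}(x_2)\rho_{x_1,x_2}$ and $\bar\rho=\sum_{x_1}p_{X_1}(x_1)\bar\rho_{x_1}$. Given codebooks $\{x_1^n(m_1)\}_{m_1=1}^{M_1}\subseteq\mathcal X_1^n$ and $\{x_2^n(m_2)\}_{m_2=1}^{M_2}\subseteq\mathcal X_2^n$, let $\Pi_{\bar\rho}=\Pi^n_{\bar\rho,\eta}$; let $\Pi_{m_1}$ be the conditionally typical projector of the ensemble $\{p_{X_1}(x_1),\bar\rho_{x_1}\}$ for $x_1^n(m_1)$; and let $\Pi_{m_1,m_2}$ be that of $\{p_{X_1}(x_1)p_{X_2}(x_2),\rho_{x_1,x_2}\}$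 for $(x_1^n(m_1),x_2^n(m_2))$, all with parameter $\eta$. Put $$P_{m_1,m_2}=\Pi_{\bar\rho}\,\Pi_{m_1}\,\Pi_{m_1,m_2}\,\Pi_{m_1}\,\Pi_{\bar\rho},\qquad S=\sum_{m_1,m_2}P_{m_1,m_2},\qquad \Lambda_{m_1,m_2}=S^{-1/2}P_{m_1,m_2}S^{-1/2},$$ where $S^{-1/2}$ is the inverse square root on the support of $S$ and zero on its kernel, and let $\widehat\Lambda_{m_1,m_2}=\Lambda_{m_1,m_2}+\frac1{M_1M_2}\bigl(I-\sum_{m_1',m_2'}\Lambda_{m_1',m_2'}\bigr)$, so that $\widehat\Lambda=\Lambda$ if $S$ is invertible. For a family $\Lambda$ indexed by the message pairs let $$\bar p_e(\Lambda)=\frac1{M_1M_2}\sum_{m_1,m_2}\mathrm{Tr}\Bigl[(I-\Lambda_{m_1,m_2})\bigotimes_{i=1}^n\rho_{x_{1,i}(m_1),x_{2,i}(m_2)}\Bigr].$$ \emph{Claim.} Let $R_1,R_2$ be real numbers with $$R_1\le I(X_1;B|X_2)_\theta,\qquad R_2\le I(X_2;B|X_1)_\theta,\qquad R_1+R_2\le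 I(X_1X_2;B)_\theta,$$ and let $\epsilon>0$, $\eta>0$ and $\delta>2\eta$. Then there is an $N$ such that for all $n\ge N$ and all integers $M_1,M_2$ with $1\le M_1\le\lceil2^{n(R_1-\delta)}\rceil$ and $1\le M_2\le\lceil2^{n(R_2-\delta)}\rceil$: for every pair of codebooks, $\{\widehat\Lambda_{m_1,m_2}\}$ is a POVM (positive semidefinite operators with sum $I$); and if all letters of all codewords are drawn independently, those of the first codebook from $p_{X_1}$ and those of the second from $p_{X_2}$, then $$\mathbb E\bigl[\bar p_e(\Lambda)\bigr]\le\epsilon\qquad\text{and}\qquad\mathbb E\bigl[\bar p_e(\widehat\Lambda)\bigr]\le\epsilon .$$ -/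

import Mathlib

open scoped Kronecker ComplexOrder

noncomputable section

namespace QMAC

/-- A density matrix on the finite-dimensional Hilbert space with orthonormal basis indexed
by `b`: a positive semidefinite complex matrix of trace one. -/
structure DensityMatrix (b : Type*) [Fintype b] where
  mat : Matrix b b ℂ
  posSemidef : mat.PosSemidef
  trace_eq_one : mat.trace = 1

/-- The average `∑ x, p x • σ x` of a finite ensemble of states. -/
def DensityMatrix.average {X b : Type*} [Fintype X] [Fintype b]
    (p : stdSimplex ℝ X) (σ : X → DensityMatrix b) : DensityMatrix b where
  mat := ∑ x, (p x : ℂ) • (σ x).mat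
  posSemidef := by
    refine Matrix.posSemidef_sum _ fun x _ => (σ x).posSemidef.smul ?_
    exact_mod_cast p.2.1 x
  trace_eq_one := by
    have h : ∑ x, p x = 1 := p.2.2
    simp only [Matrix.trace_sum, Matrix.trace_smul, (σ _).trace_eq_one, smul_eq_mul, mul_one]
    exact_mod_cast h

/-- The tensor product `σ₁ ⊗ ⋯ ⊗ σₙ`, a matrix on the space with basis indexed by `bⁿ`. -/
def tensorState {b : Type*} [Fintype b] {n : ℕ} (σ : Fin n → DensityMatrix b) :
    Matrix (Fin n → b) (Fin n → b) ℂ :=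
  fun y z => ∏ i, (σ i).mat (y i) (z i)

/-! ### Entropies -/

/-- The von Neumann entropy `-Tr (ρ log₂ ρ)`, in bits. The logarithm is taken through the
spectral decomposition (with `0 log 0 = 0`). -/
def entropy {b : Type*} [Fintype b] [DecidableEq b] (ρ : Matrix b b ℂ) : ℝ :=
  -(ρ * cfc (Real.logb 2) ρ).trace.re

/-- Partial trace over the left tensor factor. -/
def traceLeft {α β : Type*} [Fintype α] (ρ : Matrix (α × β) (α × β) ℂ) : Matrix β β ℂ :=
  fun j j' => ∑ i, ρ (i, j) (i, j')

/-- Partial trace over the right tensor factor. -/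
def traceRight {α β : Type*} [Fintype β] (ρ : Matrix (α × β) (α × β) ℂ) : Matrix α α ℂ :=
  fun i i' => ∑ j, ρ (i, j) (i', j)

/-- `I(A;B) = H(A) + H(B) - H(AB)` for a state on the system `AB`. -/
def mutualInfo {α β : Type*} [Fintype α] [DecidableEq α] [Fintype β] [DecidableEq β]
    (ρ : Matrix (α × β) (α × β) ℂ) : ℝ :=
  entropy (traceRight ρ) + entropy (traceLeft ρ) - entropy ρ

/-- `I(A;B|C) = H(AC) + H(BC) - H(ABC) - H(C)` for a state on a system whose factors are
ordered as `A`, `C`, `B`. -/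
def condMutualInfo {α γ β : Type*} [Fintype α] [DecidableEq α] [Fintype γ] [DecidableEq γ]
    [Fintype β] [DecidableEq β] (ρ : Matrix (α × γ × β) (α × γ × β) ℂ) : ℝ :=
  entropy (traceRight (ρ.submatrix (Equiv.prodAssoc α γ β) (Equiv.prodAssoc α γ β)))
    + entropy (traceLeft ρ) - entropy ρ - entropy (traceRight (traceLeft ρ))

section Theta

variable {X₁ X₂ b : Type*} [Fintype X₁] [DecidableEq X₁] [Fintype X₂] [DecidableEq X₂]
  [Fintype b] [DecidableEq b]

/-- The classical-quantum state
`θ = ∑ x₁ x₂, p₁(x₁) p₂(x₂) |x₁⟩⟨x₁| ⊗ |x₂⟩⟨x₂| ⊗ ρ x₁ x₂` on `X₁ X₂ B`. -/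
def cqState (p₁ : stdSimplex ℝ X₁) (p₂ : stdSimplex ℝ X₂) (ρ : X₁ → X₂ → DensityMatrix b) :
    Matrix (X₁ × X₂ × b) (X₁ × X₂ × b) ℂ :=
  ∑ x₁, ∑ x₂, ((p₁ x₁ : ℂ) * (p₂ x₂ : ℂ)) •
    (Matrix.single x₁ x₁ (1 : ℂ) ⊗ₖ (Matrix.single x₂ x₂ (1 : ℂ) ⊗ₖ (ρ x₁ x₂).mat))

/-- `I(X₁;B|X₂)` for the state `θ`. -/
def infoOne (p₁ : stdSimplex ℝ X₁) (p₂ : stdSimplex ℝ X₂) (ρ : X₁ → X₂ → DensityMatrix b) : ℝ :=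
  condMutualInfo (cqState p₁ p₂ ρ)

/-- `I(X₂;B|X₁)` for the state `θ`, whose factors are first reordered as `X₂`, `X₁`, `B`. -/
def infoTwo (p₁ : stdSimplex ℝ X₁) (p₂ : stdSimplex ℝ X₂) (ρ : X₁ → X₂ → DensityMatrix b) : ℝ :=
  condMutualInfo ((cqState p₁ p₂ ρ).submatrix
    (fun q : X₂ × X₁ × b => (q.2.1, q.1, q.2.2)) (fun q : X₂ × X₁ × b => (q.2.1, q.1, q.2.2)))

/-- `I(X₁X₂;B)` for the state `θ`. -/
def infoBoth (p₁ : stdSimplex ℝ X₁) (p₂ : stdSimplex ℝ X₂) (ρ : X₁ → X₂ → DensityMatrix b) : ℝ :=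
  mutualInfo ((cqState p₁ p₂ ρ).submatrix (Equiv.prodAssoc X₁ X₂ b) (Equiv.prodAssoc X₁ X₂ b))

end Theta

/-! ### Typical projectors -/

section Typical

variable {b : Type*} [Fintype b] [DecidableEq b] {n : ℕ}

/-- The eigenvalues of a state, listed with multiplicity. -/
def DensityMatrix.eigenvalue (σ : DensityMatrix b) : b → ℝ :=
  σ.posSemidef.isHermitian.eigenvalues

/-- The eigenvector of `σ` that belongs to the eigenvalue `σ.eigenvalue y`; these form an
orthonormal basis. -/
def DensityMatrix.eigenvector (σ : DensityMatrix b) (y : b) : b → ℂ :=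
  fun a => σ.posSemidef.isHermitian.eigenvectorBasis y a

/-- The sequence `y` of eigenvalue labels is `η`-typical for `σ₁ ⊗ ⋯ ⊗ σₙ` and the entropy
`H`: `|-(1/n) log₂ ∏ᵢ λᵢ(yᵢ) - H| ≤ η`, where the product is positive (for a vanishing product
the left side is infinite). -/
def IsTypical (σ : Fin n → DensityMatrix b) (H η : ℝ) (y : Fin n → b) : Prop :=
  0 < ∏ i, (σ i).eigenvalue (y i) ∧
    |-Real.logb 2 (∏ i, (σ i).eigenvalue (y i)) / n - H| ≤ η

open Classical in
/-- The projector onto the span of the product eigenvectors of `σ₁ ⊗ ⋯ ⊗ σₙ` whose labels are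
`η`-typical. -/
def projector (σ : Fin n → DensityMatrix b) (H η : ℝ) : Matrix (Fin n → b) (Fin n → b) ℂ :=
  ∑ y ∈ Finset.univ.filter (IsTypical σ H η),
    Matrix.vecMulVec (fun a : Fin n → b => ∏ i, (σ i).eigenvector (y i) (a i))
      (star fun a : Fin n → b => ∏ i, (σ i).eigenvector (y i) (a i))

/-- The typical projector of `σ^{⊗ n}`. -/
def typicalProjector (σ : DensityMatrix b) (η : ℝ) (n : ℕ) :
    Matrix (Fin n → b) (Fin n → b) ℂ :=
  projector (fun _ : Fin n => σ) (entropy σ.mat) η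

/-- The conditionally typical projector of `σ_{x₁} ⊗ ⋯ ⊗ σ_{xₙ}` for the ensemble `(p, σ)`; the
reference entropy is the conditional entropy `H(B|X) = ∑ x, p x * H(σ x)`. -/
def condTypicalProjector {X : Type*} [Fintype X] (p : X → ℝ) (σ : X → DensityMatrix b) (η : ℝ)
    (x : Fin n → X) : Matrix (Fin n → b) (Fin n → b) ℂ :=
  projector (fun i => σ (x i)) (∑ a, p a * entropy (σ a).mat) η

end Typical

/-! ### Square-root measurements -/

section Measurement

variable {K d : Type*} [Fintype K] [Fintype d] [DecidableEq d]

/-- A positive operator-valued measure with outcomes in `K`. -/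
def IsPOVM (Λ : K → Matrix d d ℂ) : Prop :=
  (∀ k, (Λ k).PosSemidef) ∧ ∑ k, Λ k = 1

/-- `S ^ (-1/2)` for a positive semidefinite matrix: the inverse square root on the support of
`S` and zero on its kernel. -/
def invSqrt (S : Matrix d d ℂ) : Matrix d d ℂ :=
  cfc (fun t : ℝ => (Real.sqrt t)⁻¹) S

/-- The square-root operators `(∑ P)^{-1/2} P k (∑ P)^{-1/2}`; they sum to the projector onto
the support of `∑ P`. -/
def squareRootOp (P : K → Matrix d d ℂ) (k : K) : Matrix d d ℂ :=
  invSqrt (∑ j, P j) * P k * invSqrt (∑ j, P j)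

/-- The square-root measurement: the square-root operators, where the projector onto the kernel
of `∑ P` (zero if `∑ P` is invertible) is shared equally among the outcomes, so that the
operators sum to the identity. -/
def squareRootPOVM (P : K → Matrix d d ℂ) (k : K) : Matrix d d ℂ :=
  squareRootOp P k + ((Fintype.card K : ℂ)⁻¹) • (1 - ∑ j, squareRootOp P j)

end Measurement

/-! ### Random codes for the multiple access channel -/

section Code

variable {X₁ X₂ b : Type*} [Fintype X₁] [Fintype X₂] [Fintype b] [DecidableEq b]
  {n M₁ M₂ : ℕ}

/-- The sandwich `Π_ρ̄ Π_{m₁} Π_{m₁,m₂} Π_{m₁} Π_ρ̄` of typical projectors with parameter `η`, for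
the codebooks `c₁`, `c₂`. -/
def sandwich (p₁ : stdSimplex ℝ X₁) (p₂ : stdSimplex ℝ X₂) (ρ : X₁ → X₂ → DensityMatrix b)
    (η : ℝ) (c₁ : Fin M₁ → Fin n → X₁) (c₂ : Fin M₂ → Fin n → X₂) (m : Fin M₁ × Fin M₂) :
    Matrix (Fin n → b) (Fin n → b) ℂ :=
  let ρ₁ : X₁ → DensityMatrix b := fun x₁ => DensityMatrix.average p₂ (ρ x₁)
  let PiAvg := typicalProjector (DensityMatrix.average p₁ ρ₁) η n
  let PiOne := condTypicalProjector p₁ ρ₁ η (c₁ m.1)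
  let PiBoth := condTypicalProjector (fun q : X₁ × X₂ => p₁ q.1 * p₂ q.2)
    (fun q => ρ q.1 q.2) η (fun i => (c₁ m.1 i, c₂ m.2 i))
  PiAvg * PiOne * PiBoth * PiOne * PiAvg

/-- The average over all message pairs of `Tr [(1 - Λ_{m₁,m₂}) ρ_{m₁,m₂}]`, where `ρ_{m₁,m₂}` is
the output of `n` uses of the channel on the codewords of `m₁` and `m₂`. -/
def avgError (ρ : X₁ → X₂ → DensityMatrix b)
    (c₁ : Fin M₁ → Fin n → X₁) (c₂ : Fin M₂ → Fin n → X₂)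
    (Λ : Fin M₁ × Fin M₂ → Matrix (Fin n → b) (Fin n → b) ℂ) : ℝ :=
  (1 / ((M₁ : ℝ) * M₂)) * ∑ m : Fin M₁ × Fin M₂,
    ((1 - Λ m) * tensorState (fun i => ρ (c₁ m.1 i) (c₂ m.2 i))).trace.re

/-- Expectation over two independent random codebooks, all of whose letters are independent and
distributed according to `p₁` in the first and `p₂` in the second codebook. -/
def codebookExpectation (p₁ : stdSimplex ℝ X₁) (p₂ : stdSimplex ℝ X₂)
    (f : (Fin M₁ → Fin n → X₁) → (Fin M₂ → Fin n → X₂) → ℝ) : ℝ :=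
  ∑ c₁ : Fin M₁ → Fin n → X₁, ∑ c₂ : Fin M₂ → Fin n → X₂,
    (∏ m, ∏ i, p₁ (c₁ m i)) * (∏ m, ∏ i, p₂ (c₂ m i)) * f c₁ c₂

end Code

end QMAC

end

/-! The error of the square-root measurement is split by the Hayashi-Nagaoka inequality
(`hayashi_nagaoka`) into a missed detection, `1 - P k`, and false detections, the sum of the other
`P j`. Missed detections vanish by the law of large numbers, because each projector in the sandwich
is typical for the output state, possibly averaged over codewords that the projector does not see.

False detections are of three kinds. If only the second message is wrong, averaging the competing
operator over the second codeword replaces `Π_{m₁,m₂}` by at most `2^{n(H(B|X₁X₂)+η)}` times the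
state of `x₁`, and `Π_{m₁}` flattens that state to `2^{-n(H(B|X₁)-η)}`. If both are wrong, averaging
over both codewords lets `Π_ρ̄` flatten `ρ̄^{⊗n}` in the same way. If only the first is wrong, the
output averaged over the first codeword is the state of `x₂`, and no projector of the decoder
flattens it.

The way out is to insert the typical projector `Q` of `x₂` in the analysis only: `1 - Λ ≤ 2 Q(1 -
Λ)Q + 2(1 - Q)`, with Hayashi-Nagaoka applied inside the first term (`one_sub_squareRootOp_le`).
Then `Q` flattens the output in the third case and is harmless in the other two. All disturbance
estimates are operator inequalities from `conj_add_le`, so the errors add linearly and no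
gentle-measurement square roots occur. Each kind of false detection costs two factors `2^{nη}`,
which is why `δ > 2η` suffices. -/

open scoped MatrixOrder

set_option linter.unusedSectionVars false

noncomputable section

namespace QMAC

/-! ### Loewner order and the Hayashi-Nagaoka inequality -/

section LoewnerOrder

variable {d : Type*} [Fintype d] [DecidableEq d]

theorem trace_mul_nonneg {A B : Matrix d d ℂ} (hA : 0 ≤ A) (hB : 0 ≤ B) :
    0 ≤ (A * B).trace.re := by
  obtain ⟨X, rfl⟩ := CStarAlgebra.nonneg_iff_eq_star_mul_self.mp hB
  rw [← mul_assoc, Matrix.trace_mul_comm, ← mul_assoc]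
  have h := (Matrix.nonneg_iff_posSemidef.mp (star_right_conjugate_nonneg hA X)).trace_nonneg
  exact (Complex.le_def.mp h).1

theorem trace_mul_le_trace_mul {A B C : Matrix d d ℂ} (h : A ≤ B) (hC : 0 ≤ C) :
    (A * C).trace.re ≤ (B * C).trace.re := by
  have := trace_mul_nonneg (sub_nonneg.mpr h) hC
  rw [sub_mul, Matrix.trace_sub, Complex.sub_re] at this
  linarith

/-- The square root is operator monotone on matrices. -/
theorem cfc_sqrt_le_cfc_sqrt {A B : Matrix d d ℂ} (hA : 0 ≤ A) (h : A ≤ B) :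
    cfc Real.sqrt A ≤ cfc Real.sqrt B := by
  open scoped Matrix.Norms.L2Operator in
  have := CFC.sqrt_le_sqrt A B h
  rwa [CFC.sqrt_eq_real_sqrt A hA, CFC.sqrt_eq_real_sqrt B (hA.trans h),
    cfcₙ_eq_cfc, cfcₙ_eq_cfc] at this

/-- Since `t ≤ √t` on `[0, 1]`, one has `P ≤ √P`, and monotonicity of the root does the rest. -/
theorem le_cfc_sqrt {P S : Matrix d d ℂ} (hP : 0 ≤ P) (hP1 : P ≤ 1) (h : P ≤ S) :
    P ≤ cfc Real.sqrt S := by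
  refine le_trans ?_ (cfc_sqrt_le_cfc_sqrt hP h)
  have hsa : IsSelfAdjoint P := .of_nonneg hP
  conv_lhs => rw [← cfc_id' ℝ P]
  refine cfc_mono (fun t ht => ?_)
  have h0 : 0 ≤ t := spectrum_nonneg_of_nonneg hP ht
  have h1 : t ≤ 1 := by
    have := (cfc_le_one_iff (fun t : ℝ => t) P).mp (by rwa [cfc_id' ℝ P])
    exact this t ht
  exact Real.le_sqrt_of_sq_le (by nlinarith)

section InvSqrt

variable {S : Matrix d d ℂ}

theorem continuousOn_spectrum (f : ℝ → ℝ) (S : Matrix d d ℂ) :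
    ContinuousOn f (spectrum ℝ S) :=
  (Matrix.finite_real_spectrum (A := S)).continuousOn f

theorem isSelfAdjoint_invSqrt (S : Matrix d d ℂ) : IsSelfAdjoint (invSqrt S) :=
  cfc_predicate _ _

theorem invSqrt_mul_self (hS : 0 ≤ S) : invSqrt S * S = cfc Real.sqrt S := by
  have hsa : IsSelfAdjoint S := .of_nonneg hS
  conv_lhs => enter [2]; rw [← cfc_id' ℝ S]
  rw [invSqrt, ← cfc_mul _ _ _ (continuousOn_spectrum _ _) (continuousOn_spectrum _ _)]
  refine cfc_congr fun t ht => ?_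
  have h0 : 0 ≤ t := spectrum_nonneg_of_nonneg hS ht
  -- On the kernel both sides vanish because `0⁻¹ = 0`, so `S` need not be invertible.
  rcases h0.eq_or_lt with rfl | h0
  · simp
  · have := Real.sqrt_pos.mpr h0
    nth_rewrite 2 [← Real.mul_self_sqrt h0.le]
    field_simp

theorem self_mul_invSqrt (hS : 0 ≤ S) : S * invSqrt S = cfc Real.sqrt S := by
  have hsa : IsSelfAdjoint S := .of_nonneg hS
  have := congrArg star (invSqrt_mul_self hS)
  rwa [star_mul, (isSelfAdjoint_invSqrt S).star_eq, hsa.star_eq,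
    IsSelfAdjoint.star_eq (cfc_predicate _ _)] at this

theorem invSqrt_mul_mul_invSqrt_le_one (hS : 0 ≤ S) : invSqrt S * S * invSqrt S ≤ 1 := by
  rw [invSqrt_mul_self hS, invSqrt,
    ← cfc_mul _ _ _ (continuousOn_spectrum _ _) (continuousOn_spectrum _ _)]
  exact cfc_le_one _ _ fun t _ => mul_inv_le_one

end InvSqrt

/-- The Hayashi-Nagaoka operator inequality. -/
theorem hayashi_nagaoka {P T : Matrix d d ℂ} (hP : 0 ≤ P) (hP1 : P ≤ 1) (hT : 0 ≤ T) :
    1 - invSqrt (P + T) * P * invSqrt (P + T) ≤ (2 : ℝ) • (1 - P) + (4 : ℝ) • T := by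
  have hS : 0 ≤ P + T := add_nonneg hP hT
  have hGS := invSqrt_mul_self hS
  have hSG := self_mul_invSqrt hS
  have h4 := sub_nonneg.mpr (invSqrt_mul_mul_invSqrt_le_one hS)
  have h3 := sub_nonneg.mpr (le_cfc_sqrt hP hP1 (le_add_of_nonneg_right hT))
  set G := invSqrt (P + T) with hG
  have hGsa : star G = G := (isSelfAdjoint_invSqrt _).star_eq
  set R := cfc Real.sqrt (P + T)
  have h1 : 0 ≤ (2 - G) * T * (2 - G) := by
    simpa [hGsa] using star_left_conjugate_nonneg hT (2 - G)
  have h2 : 0 ≤ (G - 1) * P * (G - 1) := by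
    simpa [hGsa] using star_left_conjugate_nonneg hP (G - 1)
  rw [mul_add] at hGS
  rw [add_mul] at hSG
  -- The gap is a sum of four positive terms. The products of `G` with `P` or `T` on one side only
  -- cancel once `4R`, with `R = √S`, is written symmetrically as `2GS + 2SG` for `S = P + T`.
  have key : (2 : ℝ) • (1 - P) + (4 : ℝ) • T - (1 - G * P * G) =
      (2 - G) * T * (2 - G) + (2 : ℝ) • ((G - 1) * P * (G - 1)) + (4 : ℝ) • (R - P)
        + (1 - G * (P + T) * G) := by
    have e2 : (4 : ℝ) • R = (2 : ℝ) • (G * P + G * T) + (2 : ℝ) • (P * G + T * G) := by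
      rw [hGS, hSG, ← add_smul]; norm_num
    rw [smul_sub (4 : ℝ), e2]
    have c2 : ∀ X : Matrix d d ℂ, (2 : ℝ) • X = 2 * X := fun X => by
      rw [two_mul, two_smul]
    have c4 : ∀ X : Matrix d d ℂ, (4 : ℝ) • X = 4 * X := fun X => by
      rw [show (4 : ℝ) = 2 + 2 by norm_num, add_smul, c2, ← add_mul]; norm_num
    rw [c2, c2, c2, c2, c4, c4]
    noncomm_ring
  rw [← sub_nonneg, key]
  have := smul_nonneg (zero_le_two (α := ℝ)) h2
  have := smul_nonneg (zero_le_four (α := ℝ)) h3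
  positivity

end LoewnerOrder

/-! ### Inserting and removing projections -/

section ProjectionInequalities

variable {d : Type*} [Fintype d]

theorem _root_.IsStarProjection.conj_le_conj {A B Q : Matrix d d ℂ}
    (hQ : IsStarProjection Q) (h : A ≤ B) :
    Q * A * Q ≤ Q * B * Q := by
  simpa [hQ.isSelfAdjoint.star_eq] using star_left_conjugate_le_conjugate h Q

theorem _root_.IsStarProjection.conj_nonneg {A Q : Matrix d d ℂ}
    (hQ : IsStarProjection Q) (h : 0 ≤ A) :
    0 ≤ Q * A * Q := by
  simpa [hQ.isSelfAdjoint.star_eq] using star_left_conjugate_nonneg h Q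

theorem sandwich_nonneg {A B C : Matrix d d ℂ}
    (hA : IsStarProjection A) (hB : IsStarProjection B) (hC : 0 ≤ C) :
    0 ≤ A * B * C * B * A := by
  simpa only [mul_assoc] using hA.conj_nonneg (hB.conj_nonneg hC)

variable [DecidableEq d]

/-- Parallelogram identity: the gap is `(A - B)* D (A - B)`. It plays the role of the gentle
measurement lemma. -/
theorem conj_add_le {D : Matrix d d ℂ} (hD : 0 ≤ D) (A B : Matrix d d ℂ) :
    star (A + B) * D * (A + B) ≤ (2 : ℝ) • (star A * D * A) + (2 : ℝ) • (star B * D * B) := by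
  have h := star_left_conjugate_nonneg hD (A - B)
  rw [← sub_nonneg]
  convert h using 1
  simp only [two_smul, star_add, star_sub]
  noncomm_ring

variable {A B C D Q : Matrix d d ℂ}

theorem conj_compl_le_compl (hD : D ≤ 1) (hQ : IsStarProjection Q) :
    (1 - Q) * D * (1 - Q) ≤ 1 - Q := by
  have h := star_left_conjugate_le_conjugate hD (1 - Q)
  rwa [hQ.one_sub.isSelfAdjoint.star_eq, mul_one, hQ.one_sub.isIdempotentElem.eq] at h

theorem le_two_smul_conj_add (hD : 0 ≤ D) (hD1 : D ≤ 1) (hQ : IsStarProjection Q) :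
    D ≤ (2 : ℝ) • (Q * D * Q) + (2 : ℝ) • (1 - Q) := by
  have h := conj_add_le hD Q (1 - Q)
  rw [hQ.isSelfAdjoint.star_eq, hQ.one_sub.isSelfAdjoint.star_eq] at h
  simp only [add_sub_cancel, star_one, one_mul, mul_one] at h
  have := smul_le_smul_of_nonneg_left (conj_compl_le_compl hD1 hQ) (zero_le_two (α := ℝ))
  exact h.trans (by gcongr)

/-- The converse of `le_two_smul_conj_add`, from the decomposition `Q = 1 - (1 - Q)` instead of `1 =
Q + (1 - Q)`. -/
theorem conj_le_two_smul_add (hD : 0 ≤ D) (hD1 : D ≤ 1) (hQ : IsStarProjection Q) :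
    Q * D * Q ≤ (2 : ℝ) • D + (2 : ℝ) • (1 - Q) := by
  have h := conj_add_le hD 1 (-(1 - Q))
  rw [show (1 : Matrix d d ℂ) + -(1 - Q) = Q by abel, star_neg, hQ.isSelfAdjoint.star_eq,
    hQ.one_sub.isSelfAdjoint.star_eq] at h
  simp only [star_one, one_mul, mul_one, neg_mul, mul_neg, neg_neg] at h
  have := smul_le_smul_of_nonneg_left (conj_compl_le_compl hD1 hQ) (zero_le_two (α := ℝ))
  exact h.trans (by gcongr)

theorem _root_.IsStarProjection.conj_le_one (hQ : IsStarProjection Q) (h : A ≤ 1) :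
    Q * A * Q ≤ 1 := by
  have := hQ.conj_le_conj h
  rw [mul_one, hQ.isIdempotentElem.eq] at this
  exact this.trans hQ.le_one

theorem trace_conj_le (hQ : IsStarProjection Q) (hD : 0 ≤ D) :
    (Q * D * Q).trace.re ≤ D.trace.re := by
  rw [mul_assoc, Matrix.trace_mul_comm, mul_assoc, hQ.isIdempotentElem.eq]
  simpa [Matrix.trace_mul_comm D Q] using trace_mul_le_trace_mul hQ.le_one hD

theorem sandwich_le_one (hA : IsStarProjection A) (hB : IsStarProjection B) (hC : C ≤ 1) :
    A * B * C * B * A ≤ 1 := by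
  simpa only [mul_assoc] using hA.conj_le_one (hB.conj_le_one hC)

theorem one_sub_sandwich_le (hA : IsStarProjection A) (hB : IsStarProjection B)
    (hC : IsStarProjection C) :
    1 - A * B * C * B * A ≤ (11 : ℝ) • (1 - A) + (6 : ℝ) • (1 - B) + (4 : ℝ) • (1 - C) := by
  have h1 := conj_le_two_smul_add hB.one_sub.nonneg hB.one_sub.le_one hA
  have h2 := hA.conj_le_conj (conj_le_two_smul_add hC.one_sub.nonneg hC.one_sub.le_one hB)
  have h3 := conj_le_two_smul_add hC.one_sub.nonneg hC.one_sub.le_one hA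
  -- Telescoping: the projections are peeled off from the outside, and the conjugations are then
  -- removed by `conj_le_two_smul_add`. The constant at `1 - A` is `1 + 2 + 4 + 4 = 11`.
  have e : 1 - A * B * C * B * A =
      (1 - A) + A * (1 - B) * A + A * (B * (1 - C) * B) * A := by
    have hA' := hA.isIdempotentElem.eq
    have hB' := hB.isIdempotentElem.eq
    simp only [mul_sub, sub_mul, mul_one, hA', hB', mul_assoc]
    abel
  have e2 : A * ((2 : ℝ) • (1 - C) + (2 : ℝ) • (1 - B)) * A =
      (2 : ℝ) • (A * (1 - C) * A) + (2 : ℝ) • (A * (1 - B) * A) := by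
    simp [mul_add, add_mul]
  rw [e2] at h2
  have h4 : A * (B * (1 - C) * B) * A ≤ (2 : ℝ) • ((2 : ℝ) • (1 - C) + (2 : ℝ) • (1 - A)) +
      (2 : ℝ) • ((2 : ℝ) • (1 - B) + (2 : ℝ) • (1 - A)) := h2.trans (by gcongr)
  rw [e]
  calc _ ≤ (1 - A) + ((2 : ℝ) • (1 - B) + (2 : ℝ) • (1 - A)) +
        ((2 : ℝ) • ((2 : ℝ) • (1 - C) + (2 : ℝ) • (1 - A)) +
      (2 : ℝ) • ((2 : ℝ) • (1 - B) + (2 : ℝ) • (1 - A))) := by gcongr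
    _ = _ := by module

end ProjectionInequalities

/-! ### Square-root measurements -/

section SquareRootMeasurement

variable {K d : Type*} [Fintype K] [Fintype d] [DecidableEq d] {P : K → Matrix d d ℂ}

theorem squareRootOp_nonneg (hP : ∀ k, 0 ≤ P k) (k : K) : 0 ≤ squareRootOp P k := by
  simpa [squareRootOp, (isSelfAdjoint_invSqrt _).star_eq] using
    star_left_conjugate_nonneg (hP k) (invSqrt (∑ j, P j))

theorem sum_squareRootOp_le_one (hP : ∀ k, 0 ≤ P k) : ∑ k, squareRootOp P k ≤ 1 := by
  simp only [squareRootOp, ← Finset.sum_mul, ← Finset.mul_sum]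
  exact invSqrt_mul_mul_invSqrt_le_one (Finset.sum_nonneg fun k _ => hP k)

theorem squareRootOp_le_one (hP : ∀ k, 0 ≤ P k) (k : K) : squareRootOp P k ≤ 1 :=
  (Finset.single_le_sum (fun j _ => squareRootOp_nonneg hP j) (Finset.mem_univ k)).trans
    (sum_squareRootOp_le_one hP)

/-- Sharing out the kernel projector only enlarges each operator, so the completed measurement errs
no more than the square-root operators. -/
theorem squareRootOp_le_squareRootPOVM (hP : ∀ k, 0 ≤ P k) (k : K) :
    squareRootOp P k ≤ squareRootPOVM P k := by
  refine le_add_of_nonneg_right ?_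
  rw [Matrix.nonneg_iff_posSemidef]
  refine Matrix.PosSemidef.smul (Matrix.nonneg_iff_posSemidef.mp
    (sub_nonneg.mpr (sum_squareRootOp_le_one hP))) ?_
  positivity

theorem isPOVM_squareRootPOVM [Nonempty K] (hP : ∀ k, 0 ≤ P k) : IsPOVM (squareRootPOVM P) := by
  refine ⟨fun k => Matrix.nonneg_iff_posSemidef.mp
    ((squareRootOp_nonneg hP k).trans (squareRootOp_le_squareRootPOVM hP k)), ?_⟩
  have h : (Fintype.card K : ℂ) ≠ 0 := by exact_mod_cast Fintype.card_ne_zero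
  simp [squareRootPOVM, Finset.sum_add_distrib, ← Nat.cast_smul_eq_nsmul ℂ, smul_smul, h]

/-- The failure of a square-root measurement, in a form in which the states that the other
operators detect are first cut down by an arbitrary projection `Q`. -/
theorem one_sub_squareRootOp_le [DecidableEq K] (hP : ∀ k, 0 ≤ P k) (hP1 : ∀ k, P k ≤ 1) (k : K)
    {Q : Matrix d d ℂ} (hQ : IsStarProjection Q) :
    1 - squareRootOp P k ≤ (8 : ℝ) • (1 - P k) + (10 : ℝ) • (1 - Q)
      + (8 : ℝ) • ∑ j ∈ Finset.univ.erase k, Q * P j * Q := by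
  -- `Q` is inserted around the failure operator before Hayashi-Nagaoka is used. Afterwards it is
  -- removed from `1 - P k` alone and stays around the competing operators, where it is needed.
  have h1 := le_two_smul_conj_add (sub_nonneg.mpr (squareRootOp_le_one hP k))
    (sub_le_self _ (squareRootOp_nonneg hP k)) hQ
  have h2 := hayashi_nagaoka (hP k) (hP1 k)
    (Finset.sum_nonneg fun j (_ : j ∈ Finset.univ.erase k) => hP j)
  rw [Finset.add_sum_erase _ _ (Finset.mem_univ k)] at h2
  have h3 := hQ.conj_le_conj h2
  have h4 := conj_le_two_smul_add (sub_nonneg.mpr (hP1 k)) (sub_le_self _ (hP k)) hQ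
  have e : Q * ((2 : ℝ) • (1 - P k) + (4 : ℝ) • ∑ j ∈ Finset.univ.erase k, P j) * Q =
      (2 : ℝ) • (Q * (1 - P k) * Q) + (4 : ℝ) • ∑ j ∈ Finset.univ.erase k, Q * P j * Q := by
    simp only [mul_add, add_mul, Matrix.mul_smul, Matrix.smul_mul, Finset.mul_sum, Finset.sum_mul]
  rw [e] at h3
  refine h1.trans ?_
  calc _ ≤ (2 : ℝ) • ((2 : ℝ) • ((2 : ℝ) • (1 - P k) + (2 : ℝ) • (1 - Q)) +
        (4 : ℝ) • ∑ j ∈ Finset.univ.erase k, Q * P j * Q) + (2 : ℝ) • (1 - Q) := by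
        have h5 := h3.trans (add_le_add_left (smul_le_smul_of_nonneg_left h4 zero_le_two) _)
        have := smul_le_smul_of_nonneg_left h5 (zero_le_two (α := ℝ))
        exact add_le_add_left this _
    _ = _ := by module

end SquareRootMeasurement

/-! ### Matrices diagonal in a fixed orthonormal basis -/

section UnitaryDiagonal

variable {ι : Type*} [Fintype ι] [DecidableEq ι]

/-- The matrix with eigenvalues `f` in the orthonormal basis of the columns of `U`. -/
def unitaryDiag (U : Matrix.unitaryGroup ι ℂ) (f : ι → ℝ) : Matrix ι ι ℂ :=
  U.1 * Matrix.diagonal (fun i => (f i : ℂ)) * star U.1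

variable (U : Matrix.unitaryGroup ι ℂ) (f g : ι → ℝ)

theorem unitaryDiag_mul : unitaryDiag U f * unitaryDiag U g = unitaryDiag U (f * g) := by
  have h : star U.1 * U.1 = 1 := Unitary.coe_star_mul_self U
  calc _ = U.1 * Matrix.diagonal (fun i => (f i : ℂ)) * (star U.1 * U.1) *
        Matrix.diagonal (fun i => (g i : ℂ)) * star U.1 := by
        simp only [unitaryDiag, mul_assoc]
    _ = _ := by
        rw [h, mul_one, mul_assoc U.1, Matrix.diagonal_mul_diagonal, unitaryDiag]
        simp

theorem unitaryDiag_sub : unitaryDiag U f - unitaryDiag U g = unitaryDiag U (f - g) := by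
  rw [unitaryDiag, unitaryDiag, unitaryDiag, ← sub_mul, ← mul_sub, Matrix.diagonal_sub]
  simp

theorem unitaryDiag_one : unitaryDiag U 1 = 1 := by
  simp [unitaryDiag]

theorem smul_unitaryDiag (r : ℝ) : r • unitaryDiag U f = unitaryDiag U (r • f) := by
  rw [unitaryDiag, unitaryDiag, ← Matrix.smul_mul, ← Matrix.mul_smul, ← Matrix.diagonal_smul]
  congr 3
  ext i
  simp

theorem trace_unitaryDiag : (unitaryDiag U f).trace = ∑ i, (f i : ℂ) := by
  have h : star U.1 * U.1 = 1 := Unitary.coe_star_mul_self U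
  rw [unitaryDiag, Matrix.trace_mul_comm, ← mul_assoc, h, one_mul, Matrix.trace_diagonal]

theorem charpoly_unitaryDiag :
    (unitaryDiag U f).charpoly = ∏ i, (Polynomial.X - Polynomial.C (f i : ℂ)) := by
  have h : star U.1 * U.1 = 1 := Unitary.coe_star_mul_self U
  rw [unitaryDiag, Matrix.charpoly_mul_comm, ← mul_assoc, h, one_mul, Matrix.charpoly_diagonal]

theorem star_unitaryDiag : star (unitaryDiag U f) = unitaryDiag U f := by
  simp [unitaryDiag, Matrix.star_eq_conjTranspose, Matrix.diagonal_conjTranspose, mul_assoc,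
    Pi.star_def]

variable {f g}

theorem unitaryDiag_nonneg (hf : ∀ i, 0 ≤ f i) : 0 ≤ unitaryDiag U f := by
  refine star_right_conjugate_nonneg ?_ U.1
  rw [Matrix.nonneg_iff_posSemidef]
  exact Matrix.PosSemidef.diagonal fun i => Complex.zero_le_real.mpr (hf i)

theorem unitaryDiag_mono (h : ∀ i, f i ≤ g i) : unitaryDiag U f ≤ unitaryDiag U g := by
  rw [← sub_nonneg, unitaryDiag_sub]
  exact unitaryDiag_nonneg U fun i => sub_nonneg.mpr (h i)

end UnitaryDiagonal

/-! ### Tensor products of states and their typical projectors -/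

section TensorPower

variable {b : Type*} [Fintype b] {n : ℕ}

/-- The tensor product of `n` square matrices. -/
def tensorMatrix (V : Fin n → Matrix b b ℂ) : Matrix (Fin n → b) (Fin n → b) ℂ :=
  fun y z => ∏ i, V i (y i) (z i)

theorem tensorMatrix_mul (V W : Fin n → Matrix b b ℂ) :
    tensorMatrix V * tensorMatrix W = tensorMatrix fun i => V i * W i := by
  ext y z
  simp only [tensorMatrix, Matrix.mul_apply, ← Finset.prod_mul_distrib]
  rw [Finset.prod_univ_sum, Fintype.piFinset_univ]

theorem star_tensorMatrix (V : Fin n → Matrix b b ℂ) :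
    star (tensorMatrix V) = tensorMatrix fun i => star (V i) := by
  ext y z
  simp [tensorMatrix, Matrix.star_apply]

variable [DecidableEq b]

theorem tensorMatrix_diagonal (f : Fin n → b → ℂ) :
    tensorMatrix (fun i => Matrix.diagonal (f i)) = Matrix.diagonal fun y => ∏ i, f i (y i) := by
  ext y z
  rw [tensorMatrix, Matrix.diagonal_apply]
  split_ifs with h
  · simp [h]
  · obtain ⟨i, hi⟩ := Function.ne_iff.mp h
    exact Finset.prod_eq_zero (Finset.mem_univ i) (by simp [hi])

theorem tensorMatrix_one : tensorMatrix (fun _ : Fin n => (1 : Matrix b b ℂ)) = 1 := by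
  simpa using tensorMatrix_diagonal (fun (_ : Fin n) (_ : b) => (1 : ℂ))

/-- The tensor product of unitary matrices. -/
def tensorUnitary (V : Fin n → Matrix.unitaryGroup b ℂ) : Matrix.unitaryGroup (Fin n → b) ℂ :=
  ⟨tensorMatrix fun i => (V i).1, Matrix.mem_unitaryGroup_iff.mpr <| by
    rw [star_tensorMatrix, tensorMatrix_mul]
    simp [tensorMatrix_one]⟩

theorem tensorMatrix_unitaryDiag (V : Fin n → Matrix.unitaryGroup b ℂ) (f : Fin n → b → ℝ) :
    tensorMatrix (fun i => unitaryDiag (V i) (f i)) =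
      unitaryDiag (tensorUnitary V) fun y => ∏ i, f i (y i) := by
  simp only [unitaryDiag, ← tensorMatrix_mul, tensorUnitary, star_tensorMatrix,
    tensorMatrix_diagonal, Complex.ofReal_prod]

/-- The eigenbasis of a state, as a unitary matrix. -/
def DensityMatrix.unitary (σ : DensityMatrix b) : Matrix.unitaryGroup b ℂ :=
  σ.posSemidef.isHermitian.eigenvectorUnitary

theorem DensityMatrix.mat_eq (σ : DensityMatrix b) :
    σ.mat = unitaryDiag σ.unitary σ.eigenvalue :=
  σ.posSemidef.isHermitian.spectral_theorem

theorem DensityMatrix.eigenvalue_nonneg (σ : DensityMatrix b) (y : b) : 0 ≤ σ.eigenvalue y :=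
  σ.posSemidef.eigenvalues_nonneg y

theorem DensityMatrix.sum_eigenvalue (σ : DensityMatrix b) : ∑ y, σ.eigenvalue y = 1 := by
  have h := σ.trace_eq_one
  rw [σ.mat_eq, trace_unitaryDiag] at h
  exact_mod_cast h

theorem tensorState_eq (σ : Fin n → DensityMatrix b) :
    tensorState σ = unitaryDiag (tensorUnitary fun i => (σ i).unitary)
      fun y => ∏ i, (σ i).eigenvalue (y i) := by
  rw [← tensorMatrix_unitaryDiag]
  simp only [← DensityMatrix.mat_eq]
  rfl

theorem tensorState_nonneg (σ : Fin n → DensityMatrix b) : 0 ≤ tensorState σ := by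
  rw [tensorState_eq]
  exact unitaryDiag_nonneg _ fun y => Finset.prod_nonneg fun i _ => (σ i).eigenvalue_nonneg _

theorem sum_prod_eigenvalue (σ : Fin n → DensityMatrix b) :
    ∑ y : Fin n → b, ∏ i, (σ i).eigenvalue (y i) = 1 := by
  rw [← Fintype.piFinset_univ, ← Finset.prod_univ_sum]
  simp [DensityMatrix.sum_eigenvalue]

theorem trace_tensorState (σ : Fin n → DensityMatrix b) : (tensorState σ).trace = 1 := by
  rw [tensorState_eq, trace_unitaryDiag]
  exact_mod_cast sum_prod_eigenvalue σ

/-- Averaging the factors of a tensor product independently gives the product of averages. -/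
theorem sum_smul_tensorState {X : Type*} [Fintype X] (p : stdSimplex ℝ X)
    (σ : Fin n → X → DensityMatrix b) :
    ∑ x : Fin n → X, (∏ i, p (x i)) • tensorState (fun i => σ i (x i)) =
      tensorState fun i => DensityMatrix.average p (σ i) := by
  ext y z
  simp only [tensorState, DensityMatrix.average, Matrix.sum_apply, Matrix.smul_apply,
    Complex.real_smul, smul_eq_mul, Complex.ofReal_prod, ← Finset.prod_mul_distrib]
  rw [Finset.prod_univ_sum, Fintype.piFinset_univ]

section Projector

variable (σ : Fin n → DensityMatrix b) (H η : ℝ)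

-- The projector is diagonal in the eigenbasis of `tensorState_eq`. Operator relations between the
-- two thus become pointwise relations between functions of the label sequence.
open Classical in
theorem projector_eq : projector σ H η = unitaryDiag (tensorUnitary fun i => (σ i).unitary)
    fun y => if IsTypical σ H η y then 1 else 0 := by
  have hU : ∀ (a y : Fin n → b), (tensorUnitary fun i => (σ i).unitary).1 a y =
      ∏ i, (σ i).eigenvector (y i) (a i) := fun a y => by
    simp only [tensorUnitary, tensorMatrix, DensityMatrix.unitary, DensityMatrix.eigenvector,
      Matrix.IsHermitian.eigenvectorUnitary_apply]
  ext a c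
  rw [projector, Matrix.sum_apply, Finset.sum_filter, unitaryDiag, Matrix.mul_apply]
  refine Finset.sum_congr rfl fun y _ => ?_
  rw [Matrix.mul_diagonal, Matrix.star_apply, hU, hU, Matrix.vecMulVec_apply, Pi.star_apply]
  split_ifs <;> simp

theorem isStarProjection_projector : IsStarProjection (projector σ H η) := by
  rw [projector_eq]
  refine ⟨?_, star_unitaryDiag _ _⟩
  rw [IsIdempotentElem, unitaryDiag_mul]
  congr 1
  ext y
  simp

variable {σ H η}

theorem IsTypical.two_rpow_le (hn : 0 < n) {y : Fin n → b} (h : IsTypical σ H η y) :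
    (2 : ℝ) ^ (-(n * (H + η))) ≤ ∏ i, (σ i).eigenvalue (y i) := by
  have hn' : (0 : ℝ) < n := by exact_mod_cast hn
  rw [← Real.le_logb_iff_rpow_le one_lt_two h.1]
  have := (abs_le.mp h.2).2
  have : -Real.logb 2 (∏ i, (σ i).eigenvalue (y i)) / n ≤ H + η := by linarith
  rw [div_le_iff₀ hn'] at this
  linarith

theorem IsTypical.le_two_rpow (hn : 0 < n) {y : Fin n → b} (h : IsTypical σ H η y) :
    ∏ i, (σ i).eigenvalue (y i) ≤ (2 : ℝ) ^ (-(n * (H - η))) := by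
  have hn' : (0 : ℝ) < n := by exact_mod_cast hn
  rw [← Real.logb_le_iff_le_rpow one_lt_two h.1]
  have := (abs_le.mp h.2).1
  have : H - η ≤ -Real.logb 2 (∏ i, (σ i).eigenvalue (y i)) / n := by linarith
  rw [le_div_iff₀ hn'] at this
  linarith

variable (σ H η)

/-- Typical eigenvalues are at least `2^{-n(H+η)}`. This serves both as a rank bound, after taking
traces, and as a replacement of a projector by a state that can be averaged over codewords. -/
theorem projector_le_smul_tensorState (hn : 0 < n) :
    projector σ H η ≤ (2 : ℝ) ^ (n * (H + η)) • tensorState σ := by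
  rw [projector_eq, tensorState_eq, smul_unitaryDiag]
  refine unitaryDiag_mono _ fun y => ?_
  have h0 : 0 ≤ ∏ i, (σ i).eigenvalue (y i) :=
    Finset.prod_nonneg fun i _ => (σ i).eigenvalue_nonneg _
  simp only [Pi.smul_apply, smul_eq_mul]
  split_ifs with h
  · have := h.two_rpow_le hn
    rw [Real.rpow_neg zero_le_two] at this
    rwa [inv_le_iff_one_le_mul₀' (by positivity)] at this
  · positivity

theorem projector_conj_tensorState_le (hn : 0 < n) :
    projector σ H η * tensorState σ * projector σ H η ≤
      (2 : ℝ) ^ (-(n * (H - η))) • (1 : Matrix (Fin n → b) (Fin n → b) ℂ) := by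
  rw [projector_eq, tensorState_eq, unitaryDiag_mul, unitaryDiag_mul,
    ← unitaryDiag_one (tensorUnitary fun i => (σ i).unitary), smul_unitaryDiag]
  refine unitaryDiag_mono _ fun y => ?_
  by_cases h : IsTypical σ H η y
  · simpa [h] using h.le_two_rpow hn
  · simp only [Pi.mul_apply, h, if_false, Pi.smul_apply, Pi.one_apply, smul_eq_mul]
    simp only [zero_mul, mul_one]
    positivity

theorem projector_conj_tensorState_le_self :
    projector σ H η * tensorState σ * projector σ H η ≤ tensorState σ := by
  rw [projector_eq, tensorState_eq, unitaryDiag_mul, unitaryDiag_mul]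
  refine unitaryDiag_mono _ fun y => ?_
  by_cases h : IsTypical σ H η y
  · simp [h]
  · simpa [h] using Finset.prod_nonneg fun i _ => (σ i).eigenvalue_nonneg _

-- The missed weight is the classical probability of the atypical label sequences.
open Classical in
theorem trace_compl_projector_mul_tensorState :
    ((1 - projector σ H η) * tensorState σ).trace.re =
      ∑ y, if IsTypical σ H η y then 0 else ∏ i, (σ i).eigenvalue (y i) := by
  rw [projector_eq, tensorState_eq, ← unitaryDiag_one (tensorUnitary fun i => (σ i).unitary),
    unitaryDiag_sub, unitaryDiag_mul, trace_unitaryDiag, ← Complex.ofReal_sum, Complex.ofReal_re]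
  refine Finset.sum_congr rfl fun y _ => ?_
  by_cases h : IsTypical σ H η y <;> simp [h]

end Projector

end TensorPower

/-! ### Product distributions and the weak law of large numbers -/

section ProductWeights

theorem sum_prod_weights {K W : Type*} [Fintype K] [DecidableEq K] [Fintype W] {P : W → ℝ}
    (hP : ∑ w, P w = 1) : ∑ c : K → W, ∏ k, P (c k) = 1 := by
  rw [← Fintype.piFinset_univ, ← Finset.prod_univ_sum]
  simp [hP]

/-- The second moment of a sum of independent centred random variables. -/
theorem sum_prod_weights_mul_sq {W : Type*} [Fintype W] {q : W → ℝ} (hq : ∑ w, q w = 1)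
    {u : W → ℝ} (hu : ∑ w, q w * u w = 0) (n : ℕ) :
    ∑ w : Fin n → W, (∏ i, q (w i)) * (∑ i, u (w i)) ^ 2 = n * ∑ w, q w * u w ^ 2 := by
  -- Needed for every length, since it kills the cross term when the first letter is split off the
  -- square.
  have hmean : ∀ n : ℕ, ∑ w : Fin n → W, (∏ i, q (w i)) * ∑ i, u (w i) = 0 := by
    intro n
    induction n with
    | zero => simp
    | succ n ih =>
      rw [← (Fin.consEquiv fun _ => W).sum_comp, Fintype.sum_prod_type]
      simp only [Fin.consEquiv_apply, Fin.prod_univ_succ, Fin.sum_univ_succ, Fin.cons_zero,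
        Fin.cons_succ]
      have : ∀ (a : W) (w : Fin n → W), q a * (∏ i, q (w i)) * (u a + ∑ i, u (w i)) =
          (q a * u a) * (∏ i, q (w i)) + q a * ((∏ i, q (w i)) * ∑ i, u (w i)) := by
        intros; ring
      simp only [this, Finset.sum_add_distrib, ← Finset.mul_sum, ih, ← Finset.sum_mul, hu]
      simp
  induction n with
  | zero => simp
  | succ n ih =>
    rw [← (Fin.consEquiv fun _ => W).sum_comp, Fintype.sum_prod_type]
    simp only [Fin.consEquiv_apply, Fin.prod_univ_succ, Fin.sum_univ_succ, Fin.cons_zero,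
      Fin.cons_succ]
    have : ∀ (a : W) (w : Fin n → W), q a * (∏ i, q (w i)) * (u a + ∑ i, u (w i)) ^ 2 =
        (q a * u a ^ 2) * (∏ i, q (w i)) + (2 * (q a * u a)) * ((∏ i, q (w i)) * ∑ i, u (w i))
          + q a * ((∏ i, q (w i)) * (∑ i, u (w i)) ^ 2) := by
      intros; ring
    simp only [this, Finset.sum_add_distrib, ← Finset.mul_sum, ih, ← Finset.sum_mul, hq, hmean,
      sum_prod_weights hq]
    push_cast
    ring

open Classical in
/-- The weak law of large numbers for finitely supported distributions. -/
theorem exists_forall_sum_prod_weights_le {W : Type*} [Fintype W] {q : W → ℝ} (hq0 : ∀ w, 0 ≤ q w)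
    (hq : ∑ w, q w = 1) (z : W → ℝ) {η ε : ℝ} (hη : 0 < η) (hε : 0 < ε) :
    ∃ N : ℕ, ∀ n : ℕ, N ≤ n →
      ∑ w : Fin n → W, (if |(∑ i, z (w i)) / n - ∑ w, q w * z w| ≤ η then 0 else ∏ i, q (w i))
        ≤ ε := by
  set μ := ∑ w, q w * z w with hμ
  set u : W → ℝ := fun w => z w - μ with hu_def
  have hu : ∑ w, q w * u w = 0 := by
    simp [hu_def, mul_sub, ← Finset.sum_mul, hq, ← hμ]
  set v := ∑ w, q w * u w ^ 2
  -- Chebyshev: the deviation probability is at most `v / (n η²)`. The maximum with `1` keeps the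
  -- division by `n` honest.
  obtain ⟨N, hN⟩ := exists_nat_gt (v / (ε * η ^ 2))
  refine ⟨max N 1, fun n hn => ?_⟩
  have hn0 : (0 : ℝ) < n := by
    have : 0 < n := lt_of_lt_of_le one_pos ((le_max_right N 1).trans hn)
    exact_mod_cast this
  have hvn : v ≤ n * (ε * η ^ 2) := by
    have h1 : v / (ε * η ^ 2) ≤ n := hN.le.trans (by exact_mod_cast (le_max_left N 1).trans hn)
    rwa [div_le_iff₀ (by positivity)] at h1
  have hterm : ∀ w : Fin n → W,
      (if |(∑ i, z (w i)) / n - μ| ≤ η then 0 else ∏ i, q (w i)) ≤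
        ((∏ i, q (w i)) * (∑ i, u (w i)) ^ 2) / (n * η) ^ 2 := by
    intro w
    have hp : 0 ≤ ∏ i, q (w i) := Finset.prod_nonneg fun i _ => hq0 _
    split_ifs with h
    · positivity
    · rw [le_div_iff₀ (by positivity)]
      refine mul_le_mul_of_nonneg_left ?_ hp
      have e : (∑ i, z (w i)) / n - μ = (∑ i, u (w i)) / n := by
        simp only [hu_def, Finset.sum_sub_distrib, Finset.sum_const, Finset.card_univ,
          Fintype.card_fin, nsmul_eq_mul]
        field_simp
      rw [e, abs_div, abs_of_pos hn0, div_le_iff₀ hn0, not_le] at h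
      rw [← sq_abs (∑ i, u (w i))]
      have : (n : ℝ) * η ≤ |∑ i, u (w i)| := by linarith
      gcongr
  refine (Finset.sum_le_sum fun w _ => hterm w).trans ?_
  rw [← Finset.sum_div, sum_prod_weights_mul_sq hq hu, div_le_iff₀ (by positivity)]
  calc (n : ℝ) * v ≤ n * (n * (ε * η ^ 2)) := by gcongr
    _ = _ := by ring

/-- The marginal of one codeword in a random codebook. -/
theorem sum_prod_weights_mul_apply {K W : Type*} [Fintype K] [DecidableEq K] [Fintype W]
    {P : W → ℝ} (hP : ∑ w, P w = 1) (a : K) (g : W → ℝ) :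
    ∑ c : K → W, (∏ k, P (c k)) * g (c a) = ∑ w, P w * g w := by
  -- Absorbing `g` into the factor at `a` makes the summand a product over `K`, so the sum
  -- factorises.
  have h : ∀ c : K → W, (∏ k, P (c k)) * g (c a) =
      ∏ k, P (c k) * (if k = a then g (c k) else 1) := fun c => by
    rw [Finset.prod_mul_distrib, Finset.prod_ite_eq' Finset.univ a fun k => g (c k)]
    simp
  simp only [h]
  rw [← Fintype.piFinset_univ,
    ← Finset.prod_univ_sum (fun _ => Finset.univ) fun k w => P w * (if k = a then g w else 1),
    Finset.prod_eq_single a]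
  · simp
  · intro k _ hk
    simp [hk, hP]
  · simp

/-- The joint distribution of two different codewords in a random codebook. -/
theorem sum_prod_weights_mul_apply₂ {K W : Type*} [Fintype K] [DecidableEq K] [Fintype W]
    {P : W → ℝ} (hP : ∑ w, P w = 1) {a a' : K} (ha : a ≠ a') (g : W → W → ℝ) :
    ∑ c : K → W, (∏ k, P (c k)) * g (c a) (c a') = ∑ w, ∑ w', P w * P w' * g w w' := by
  classical
  -- Fixing the value `w'` of the second codeword turns the joint function `g` into a product of
  -- one-codeword functions.
  have hs : ∀ w' : W, ∑ c : K → W, (∏ k, P (c k)) * (g (c a) w' * if c a' = w' then 1 else 0) =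
      P w' * ∑ w, P w * g w w' := by
    intro w'
    have h : ∀ c : K → W, (∏ k, P (c k)) * (g (c a) w' * if c a' = w' then 1 else 0) =
        ∏ k, P (c k) * ((if k = a then g (c k) w' else 1) *
          (if k = a' then (if c k = w' then 1 else 0) else 1)) := fun c => by
      rw [Finset.prod_mul_distrib, Finset.prod_mul_distrib,
        Finset.prod_ite_eq' Finset.univ a fun k => g (c k) w',
        Finset.prod_ite_eq' Finset.univ a' fun k => if c k = w' then (1 : ℝ) else 0]
      simp
    simp only [h]
    rw [← Fintype.piFinset_univ, ← Finset.prod_univ_sum (fun _ => Finset.univ) fun k w =>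
      P w * ((if k = a then g w w' else 1) * (if k = a' then (if w = w' then 1 else 0) else 1)),
      Finset.prod_eq_mul a a' ha]
    · simp [ha, ha.symm, mul_comm]
    · intro k _ hk
      simp [hk.1, hk.2, hP]
    · simp
    · simp
  have h2 : ∀ c : K → W, (∏ k, P (c k)) * g (c a) (c a') =
      ∑ w', (∏ k, P (c k)) * (g (c a) w' * if c a' = w' then 1 else 0) := fun c => by
    simp
  simp only [h2]
  rw [Finset.sum_comm]
  simp only [hs, Finset.mul_sum]
  rw [Finset.sum_comm]
  refine Finset.sum_congr rfl fun w _ => Finset.sum_congr rfl fun w' _ => by ring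

end ProductWeights

/-! ### Entropies of classical-quantum states -/

section Entropy

/-- Entropy depends only on the multiset of eigenvalues, that is, on the roots of the characteristic
polynomial. Invariance under reindexing and change of basis follows at once. -/
theorem entropy_eq_of_charpoly {d ι : Type*} [Fintype d] [DecidableEq d] [Fintype ι]
    {A : Matrix d d ℂ} (hA : A.IsHermitian) (f : ι → ℝ)
    (h : A.charpoly = ∏ i, (Polynomial.X - Polynomial.C (f i : ℂ))) :
    entropy A = -∑ i, f i * Real.logb 2 (f i) := by
  have hev : entropy A = -∑ i, hA.eigenvalues i * Real.logb 2 (hA.eigenvalues i) := by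
    have hsa : IsSelfAdjoint A := hA
    have e : A * cfc (Real.logb 2) A = unitaryDiag hA.eigenvectorUnitary
        (fun i => hA.eigenvalues i * Real.logb 2 (hA.eigenvalues i)) := by
      conv_lhs => enter [1]; rw [← cfc_id' ℝ A]
      rw [← cfc_mul _ _ _ (continuousOn_spectrum _ _) (continuousOn_spectrum _ _), hA.cfc_eq]
      rfl
    rw [entropy, e, trace_unitaryDiag, ← Complex.ofReal_sum, Complex.ofReal_re]
  have hroots := hA.roots_charpoly_eq_eigenvalues
  rw [h, Polynomial.roots_prod _ _ (Finset.prod_ne_zero_iff.mpr fun i _ =>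
    Polynomial.X_sub_C_ne_zero _)] at hroots
  simp only [Polynomial.roots_X_sub_C, Multiset.bind_singleton] at hroots
  have := congrArg (fun s : Multiset ℂ =>
    (s.map fun t : ℂ => t.re * Real.logb 2 t.re).sum) hroots
  simp only [Multiset.map_map, Function.comp_def, Complex.ofReal_re] at this
  rw [hev, neg_inj]
  exact this.symm

theorem entropy_unitaryDiag {ι : Type*} [Fintype ι] [DecidableEq ι]
    (U : Matrix.unitaryGroup ι ℂ) (f : ι → ℝ) :
    entropy (unitaryDiag U f) = -∑ i, f i * Real.logb 2 (f i) :=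
  entropy_eq_of_charpoly (star_unitaryDiag U f) f (charpoly_unitaryDiag U f)

theorem DensityMatrix.entropy_eq {b : Type*} [Fintype b] [DecidableEq b] (σ : DensityMatrix b) :
    entropy σ.mat = -∑ y, σ.eigenvalue y * Real.logb 2 (σ.eigenvalue y) := by
  rw [σ.mat_eq, entropy_unitaryDiag]

theorem entropy_diagonal {X : Type*} [Fintype X] [DecidableEq X] (p : X → ℝ) :
    entropy (Matrix.diagonal fun x => (p x : ℂ)) = -∑ x, p x * Real.logb 2 (p x) := by
  simpa [unitaryDiag] using entropy_unitaryDiag 1 p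

theorem entropy_submatrix_equiv {d ι : Type*} [Fintype d] [DecidableEq d] [Fintype ι]
    [DecidableEq ι] {A : Matrix d d ℂ} (hA : A.IsHermitian) (e : ι ≃ d) :
    entropy (A.submatrix e e) = entropy A := by
  have h : (A.submatrix e e).charpoly = A.charpoly := Matrix.charpoly_reindex e.symm A
  rw [entropy_eq_of_charpoly hA _ hA.charpoly_eq,
    entropy_eq_of_charpoly (hA.submatrix e) _ (h.trans hA.charpoly_eq)]

section ClassicalQuantum

variable {X b : Type*} [Fintype X] [DecidableEq X] [Fintype b] [DecidableEq b]

/-- The classical-quantum state `∑ x, p x |x⟩⟨x| ⊗ σ x`. -/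
def ensembleState (p : X → ℝ) (σ : X → DensityMatrix b) : Matrix (X × b) (X × b) ℂ :=
  fun q q' => if q.1 = q'.1 then (p q.1 : ℂ) * (σ q.1).mat q.2 q'.2 else 0

/-- The diagonalising unitary is block diagonal, with the eigenbasis of `σ x` in block `x`. -/
theorem exists_ensembleState_eq (p : X → ℝ) (σ : X → DensityMatrix b) :
    ∃ U : Matrix.unitaryGroup (X × b) ℂ,
      ensembleState p σ = unitaryDiag U fun q => p q.1 * (σ q.1).eigenvalue q.2 := by
  obtain ⟨V, hVa⟩ : ∃ V : Matrix (X × b) (X × b) ℂ, ∀ x a x' a',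
      V (x, a) (x', a') = if x = x' then (σ x).unitary.1 a a' else 0 :=
    ⟨fun q q' => if q.1 = q'.1 then (σ q.1).unitary.1 q.2 q'.2 else 0, fun _ _ _ _ => rfl⟩
  have hV : V ∈ Matrix.unitaryGroup (X × b) ℂ := by
    rw [Matrix.mem_unitaryGroup_iff]
    ext ⟨x, a⟩ ⟨x', a'⟩
    rw [Matrix.mul_apply, Fintype.sum_prod_type]
    by_cases hx : x = x'
    · subst hx
      have h := congrFun (congrFun (Unitary.coe_mul_star_self (σ x).unitary) a) a'
      rw [Matrix.mul_apply] at h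
      rw [Unitary.coe_star] at h
      simp only [Matrix.star_apply, hVa] at h ⊢
      rw [Finset.sum_eq_single x]
      · simp only [if_true]
        rw [h]
        simp [Matrix.one_apply]
      · intro z _ hz
        simp [hz.symm]
      · simp
    · rw [Matrix.one_apply_ne (by simp [hx])]
      refine Finset.sum_eq_zero fun z _ => Finset.sum_eq_zero fun y _ => ?_
      simp only [Matrix.star_apply, hVa]
      by_cases hz : x = z
      · subst hz; simp [Ne.symm hx]
      · simp [hz]
  refine ⟨⟨V, hV⟩, ?_⟩
  ext ⟨x, a⟩ ⟨x', a'⟩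
  rw [unitaryDiag, Matrix.mul_apply, Fintype.sum_prod_type]
  simp only [Matrix.mul_diagonal, Matrix.star_apply, hVa, ensembleState]
  split_ifs with hx
  · subst hx
    rw [(σ x).mat_eq, unitaryDiag, Matrix.mul_apply, Finset.sum_eq_single x]
    · simp only [Matrix.mul_diagonal, Matrix.star_apply, if_true, Finset.mul_sum]
      refine Finset.sum_congr rfl fun y _ => ?_
      push_cast
      ring
    · intro z _ hz
      simp [hz.symm]
    · simp
  · refine (Finset.sum_eq_zero fun z _ => Finset.sum_eq_zero fun y _ => ?_).symm
    by_cases hz : x = z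
    · subst hz; simp [Ne.symm hx]
    · simp [hz]

theorem isHermitian_ensembleState (p : X → ℝ) (σ : X → DensityMatrix b) :
    (ensembleState p σ).IsHermitian := by
  obtain ⟨U, hU⟩ := exists_ensembleState_eq p σ
  rw [hU]
  exact star_unitaryDiag _ _

/-- The chain rule `H(XB) = H(X) + ∑ x, p x * H(σ x)` for classical-quantum states. -/
theorem entropy_ensembleState (p : X → ℝ) (σ : X → DensityMatrix b) :
    entropy (ensembleState p σ) =
      entropy (Matrix.diagonal fun x => (p x : ℂ)) + ∑ x, p x * entropy (σ x).mat := by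
  obtain ⟨U, hU⟩ := exists_ensembleState_eq p σ
  rw [hU, entropy_unitaryDiag, entropy_diagonal, Fintype.sum_prod_type]
  simp only [DensityMatrix.entropy_eq, mul_neg, Finset.sum_neg_distrib, ← neg_add, neg_inj]
  rw [← Finset.sum_add_distrib]
  refine Finset.sum_congr rfl fun x _ => ?_
  have h : ∀ y, p x * (σ x).eigenvalue y * Real.logb 2 (p x * (σ x).eigenvalue y) =
      p x * Real.logb 2 (p x) * (σ x).eigenvalue y +
        p x * ((σ x).eigenvalue y * Real.logb 2 ((σ x).eigenvalue y)) := by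
    -- The logarithm of the product splits only for nonzero factors; otherwise every term is zero,
    -- as `0 log 0 = 0`.
    intro y
    by_cases hp : p x = 0
    · simp [hp]
    by_cases hl : (σ x).eigenvalue y = 0
    · simp [hl]
    rw [Real.logb_mul hp hl]
    ring
  simp only [h, Finset.sum_add_distrib, ← Finset.mul_sum, (σ x).sum_eigenvalue, mul_one]

end ClassicalQuantum

/-! ### Mutual informations of the channel as entropy differences -/

section MultipleAccess

variable {X₁ X₂ b : Type*} [Fintype X₁] [DecidableEq X₁] [Fintype X₂] [DecidableEq X₂]
  [Fintype b] [DecidableEq b]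
  (p₁ : stdSimplex ℝ X₁) (p₂ : stdSimplex ℝ X₂) (ρ : X₁ → X₂ → DensityMatrix b)

theorem cqState_apply (x₁ x₁' : X₁) (x₂ x₂' : X₂) (a a' : b) :
    cqState p₁ p₂ ρ (x₁, x₂, a) (x₁', x₂', a') =
      if x₁ = x₁' ∧ x₂ = x₂' then (p₁ x₁ : ℂ) * p₂ x₂ * (ρ x₁ x₂).mat a a' else 0 := by
  simp only [cqState, Matrix.sum_apply, Matrix.smul_apply, Matrix.kroneckerMap_apply, smul_eq_mul]
  rw [Finset.sum_eq_single x₁, Finset.sum_eq_single x₂]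
  · by_cases h₁ : x₁ = x₁' <;> by_cases h₂ : x₂ = x₂' <;> simp [h₁, h₂]
  · intro z _ hz
    simp [Matrix.single_apply, hz]
  · simp
  · intro z _ hz
    simp [Matrix.single_apply, hz]
  · simp

theorem cqState_submatrix_prodAssoc :
    (cqState p₁ p₂ ρ).submatrix (Equiv.prodAssoc X₁ X₂ b) (Equiv.prodAssoc X₁ X₂ b) =
      ensembleState (fun q : X₁ × X₂ => p₁ q.1 * p₂ q.2) fun q => ρ q.1 q.2 := by
  ext ⟨⟨x₁, x₂⟩, a⟩ ⟨⟨x₁', x₂'⟩, a'⟩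
  simp [cqState_apply, ensembleState]

theorem cqState_submatrix_swap :
    (cqState p₁ p₂ ρ).submatrix
      (fun q : X₂ × X₁ × b => (q.2.1, q.1, q.2.2)) (fun q : X₂ × X₁ × b => (q.2.1, q.1, q.2.2)) =
      cqState p₂ p₁ fun x₂ x₁ => ρ x₁ x₂ := by
  ext ⟨x₂, x₁, a⟩ ⟨x₂', x₁', a'⟩
  simp [cqState_apply, and_comm, mul_comm]

theorem traceRight_ensembleState {X : Type*} [Fintype X] [DecidableEq X] (p : X → ℝ)
    (σ : X → DensityMatrix b) :
    traceRight (ensembleState p σ) = Matrix.diagonal fun x => (p x : ℂ) := by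
  ext x x'
  rw [traceRight, Matrix.diagonal_apply]
  simp only [ensembleState]
  split_ifs with h
  · subst h
    have := (σ x).trace_eq_one
    rw [Matrix.trace] at this
    simp only [Matrix.diag_apply] at this
    rw [← Finset.mul_sum, this, mul_one]
  · simp

theorem traceLeft_cqState :
    traceLeft (cqState p₁ p₂ ρ) =
      ensembleState p₂ fun x₂ => DensityMatrix.average p₁ fun x₁ => ρ x₁ x₂ := by
  ext ⟨x₂, a⟩ ⟨x₂', a'⟩
  simp only [traceLeft, ensembleState, DensityMatrix.average, cqState_apply, Matrix.sum_apply,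
    true_and, Matrix.smul_apply, smul_eq_mul, Finset.mul_sum]
  split_ifs with h
  · exact Finset.sum_congr rfl fun x _ => by ring
  · simp

theorem entropy_cqState :
    entropy (cqState p₁ p₂ ρ) =
      entropy (ensembleState (fun q : X₁ × X₂ => p₁ q.1 * p₂ q.2) fun q => ρ q.1 q.2) := by
  have h := cqState_submatrix_prodAssoc p₁ p₂ ρ
  have h2 : cqState p₁ p₂ ρ = (ensembleState (fun q : X₁ × X₂ => p₁ q.1 * p₂ q.2)
      fun q => ρ q.1 q.2).submatrix (Equiv.prodAssoc X₁ X₂ b).symm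
        (Equiv.prodAssoc X₁ X₂ b).symm := by
    rw [← h, Matrix.submatrix_submatrix]
    simp
  rw [h2, entropy_submatrix_equiv (isHermitian_ensembleState _ _)]

/-- `I(X₁;B|X₂) = H(B|X₂) - H(B|X₁X₂)`. -/
theorem infoOne_eq : infoOne p₁ p₂ ρ =
    (∑ x₂, p₂ x₂ * entropy (DensityMatrix.average p₁ fun x₁ => ρ x₁ x₂).mat) -
      ∑ q : X₁ × X₂, p₁ q.1 * p₂ q.2 * entropy (ρ q.1 q.2).mat := by
  rw [infoOne, condMutualInfo, entropy_cqState, cqState_submatrix_prodAssoc, traceLeft_cqState,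
    traceRight_ensembleState, traceRight_ensembleState, entropy_ensembleState,
    entropy_ensembleState]
  ring

/-- `I(X₂;B|X₁) = H(B|X₁) - H(B|X₁X₂)`. -/
theorem infoTwo_eq : infoTwo p₁ p₂ ρ =
    (∑ x₁, p₁ x₁ * entropy (DensityMatrix.average p₂ (ρ x₁)).mat) -
      ∑ q : X₁ × X₂, p₁ q.1 * p₂ q.2 * entropy (ρ q.1 q.2).mat := by
  rw [infoTwo, cqState_submatrix_swap]
  refine (infoOne_eq p₂ p₁ fun x₂ x₁ => ρ x₁ x₂).trans (congrArg _ ?_)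
  rw [← (Equiv.prodComm X₂ X₁).sum_comp]
  exact Finset.sum_congr rfl fun q _ => by simp [mul_comm (p₁ q.2)]

/-- `I(X₁X₂;B) = H(B) - H(B|X₁X₂)`. -/
theorem infoBoth_eq : infoBoth p₁ p₂ ρ =
    entropy (DensityMatrix.average p₁ fun x₁ => DensityMatrix.average p₂ (ρ x₁)).mat -
      ∑ q : X₁ × X₂, p₁ q.1 * p₂ q.2 * entropy (ρ q.1 q.2).mat := by
  have h : traceLeft (ensembleState (fun q : X₁ × X₂ => p₁ q.1 * p₂ q.2) fun q => ρ q.1 q.2) =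
      (DensityMatrix.average p₁ fun x₁ => DensityMatrix.average p₂ (ρ x₁)).mat := by
    ext a a'
    simp [traceLeft, ensembleState, DensityMatrix.average, Matrix.sum_apply, Fintype.sum_prod_type,
      Finset.mul_sum, mul_assoc]
  rw [infoBoth, mutualInfo, cqState_submatrix_prodAssoc, traceRight_ensembleState, h,
    entropy_ensembleState]
  ring

end MultipleAccess

end Entropy

/-! ### Typicality of channel outputs -/

section Typicality

variable {X b : Type*} [Fintype X] [Fintype b] [DecidableEq b]

/-- The output of a classical-quantum channel passes the conditionally typical projector with
high probability. -/
theorem exists_forall_condTypicalProjector_le {p : X → ℝ} (hp0 : ∀ x, 0 ≤ p x)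
    (hp : ∑ x, p x = 1) (σ : X → DensityMatrix b) {η ε : ℝ} (hη : 0 < η) (hε : 0 < ε) :
    ∃ N : ℕ, ∀ n : ℕ, N ≤ n → ∑ x : Fin n → X, (∏ i, p (x i)) *
      ((1 - condTypicalProjector p σ η x) * tensorState fun i => σ (x i)).trace.re ≤ ε := by
  classical
  -- Letters and eigenvalue labels form one classical source, whose information variable `z` has
  -- mean `H(B|X)`. For a vanishing eigenvalue `z` takes the default value `0`, but `q` vanishes
  -- there too.
  set q : X × b → ℝ := fun w => p w.1 * (σ w.1).eigenvalue w.2 with hq_def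
  set z : X × b → ℝ := fun w => -Real.logb 2 ((σ w.1).eigenvalue w.2) with hz_def
  have hq0 : ∀ w, 0 ≤ q w := fun w => mul_nonneg (hp0 _) ((σ w.1).eigenvalue_nonneg _)
  have hq : ∑ w, q w = 1 := by
    rw [Fintype.sum_prod_type]
    simp [hq_def, ← Finset.mul_sum, DensityMatrix.sum_eigenvalue, hp]
  have hmean : ∑ w, q w * z w = ∑ x, p x * entropy (σ x).mat := by
    rw [Fintype.sum_prod_type]
    refine Finset.sum_congr rfl fun x _ => ?_
    rw [DensityMatrix.entropy_eq, ← Finset.sum_neg_distrib, Finset.mul_sum]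
    exact Finset.sum_congr rfl fun y _ => by simp only [hq_def, hz_def]; ring
  obtain ⟨N, hN⟩ := exists_forall_sum_prod_weights_le hq0 hq z hη hε
  refine ⟨N, fun n hn => le_trans ?_ (hN n hn)⟩
  rw [← (Equiv.arrowProdEquivProdArrow (Fin n) (fun _ => X) (fun _ => b)).symm.sum_comp,
    Fintype.sum_prod_type]
  refine Finset.sum_le_sum fun x _ => ?_
  rw [condTypicalProjector, trace_compl_projector_mul_tensorState, Finset.mul_sum]
  refine Finset.sum_le_sum fun y _ => ?_
  rw [hmean]
  have hx : 0 ≤ ∏ i, p (x i) := Finset.prod_nonneg fun i _ => hp0 _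
  have hy : 0 ≤ ∏ i, (σ (x i)).eigenvalue (y i) :=
    Finset.prod_nonneg fun i _ => (σ (x i)).eigenvalue_nonneg _
  have hprod : ∏ i, q (x i, y i) = (∏ i, p (x i)) * ∏ i, (σ (x i)).eigenvalue (y i) :=
    Finset.prod_mul_distrib
  change (∏ i, p (x i)) * _ ≤ if |(∑ i, z (x i, y i)) / n - _| ≤ η then 0 else ∏ i, q (x i, y i)
  rw [hprod]
  by_cases ht : IsTypical (fun i => σ (x i)) (∑ a, p a * entropy (σ a).mat) η y
  · rw [if_pos ht, mul_zero]
    split_ifs <;> positivity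
  · rw [if_neg ht]
    -- A vanishing product is atypical by definition, but it carries no weight.
    rcases hy.eq_or_lt with h0 | h0
    · simp [← h0]
    · rw [if_neg]
      refine fun hle => ht ⟨h0, ?_⟩
      rw [Real.logb_prod _ _ fun i _ h => h0.ne' (Finset.prod_eq_zero (Finset.mem_univ i) h),
        ← Finset.sum_neg_distrib]
      exact hle

theorem exists_forall_typicalProjector_le (σ : DensityMatrix b) {η ε : ℝ} (hη : 0 < η)
    (hε : 0 < ε) : ∃ N : ℕ, ∀ n : ℕ, N ≤ n →
      ((1 - typicalProjector σ η n) * tensorState fun _ : Fin n => σ).trace.re ≤ ε := by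
  -- A single state is an ensemble over a one-letter alphabet.
  obtain ⟨N, hN⟩ := exists_forall_condTypicalProjector_le (p := fun _ : Unit => (1 : ℝ))
    (fun _ => zero_le_one) (by simp) (fun _ => σ) hη hε
  refine ⟨N, fun n hn => ?_⟩
  simpa [condTypicalProjector, typicalProjector] using hN n hn

end Typicality

/-! ### Expectations over random codebooks -/

section CodebookExpectation

variable {X₁ X₂ : Type*} [Fintype X₁] [Fintype X₂] {n M₁ M₂ : ℕ}

/-- The probability of a word whose letters are independent with distribution `p`. -/
def wordProb {X : Type*} [Fintype X] (p : stdSimplex ℝ X) (x : Fin n → X) : ℝ :=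
  ∏ i, p (x i)

theorem wordProb_nonneg {X : Type*} [Fintype X] (p : stdSimplex ℝ X) (x : Fin n → X) :
    0 ≤ wordProb p x :=
  Finset.prod_nonneg fun _ _ => p.2.1 _

theorem sum_wordProb {X : Type*} [Fintype X] (p : stdSimplex ℝ X) :
    ∑ x : Fin n → X, wordProb p x = 1 :=
  sum_prod_weights p.2.2

theorem sum_wordProb_mul_const {X : Type*} [Fintype X] (p : stdSimplex ℝ X) (r : ℝ) :
    ∑ x : Fin n → X, wordProb p x * r = r := by
  rw [← Finset.sum_mul, sum_wordProb, one_mul]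

variable (p₁ : stdSimplex ℝ X₁) (p₂ : stdSimplex ℝ X₂)

theorem codebookExpectation_mono
    {f g : (Fin M₁ → Fin n → X₁) → (Fin M₂ → Fin n → X₂) → ℝ} (h : ∀ c₁ c₂, f c₁ c₂ ≤ g c₁ c₂) :
    codebookExpectation p₁ p₂ f ≤ codebookExpectation p₁ p₂ g :=
  Finset.sum_le_sum fun c₁ _ => Finset.sum_le_sum fun c₂ _ =>
    mul_le_mul_of_nonneg_left (h c₁ c₂) <| mul_nonneg
      (Finset.prod_nonneg fun m _ => wordProb_nonneg p₁ (c₁ m))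
      (Finset.prod_nonneg fun m _ => wordProb_nonneg p₂ (c₂ m))

theorem codebookExpectation_add (f g : (Fin M₁ → Fin n → X₁) → (Fin M₂ → Fin n → X₂) → ℝ) :
    codebookExpectation p₁ p₂ (fun c₁ c₂ => f c₁ c₂ + g c₁ c₂) =
      codebookExpectation p₁ p₂ f + codebookExpectation p₁ p₂ g := by
  simp only [codebookExpectation, mul_add, Finset.sum_add_distrib]

theorem codebookExpectation_const_mul (r : ℝ)
    (f : (Fin M₁ → Fin n → X₁) → (Fin M₂ → Fin n → X₂) → ℝ) :
    codebookExpectation p₁ p₂ (fun c₁ c₂ => r * f c₁ c₂) = r * codebookExpectation p₁ p₂ f := by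
  simp only [codebookExpectation, Finset.mul_sum]
  exact Finset.sum_congr rfl fun _ _ => Finset.sum_congr rfl fun _ _ => by ring

theorem codebookExpectation_sum {J : Type*} (s : Finset J)
    (f : J → (Fin M₁ → Fin n → X₁) → (Fin M₂ → Fin n → X₂) → ℝ) :
    codebookExpectation p₁ p₂ (fun c₁ c₂ => ∑ j ∈ s, f j c₁ c₂) =
      ∑ j ∈ s, codebookExpectation p₁ p₂ (f j) := by
  simp only [codebookExpectation, Finset.mul_sum]
  exact (Finset.sum_congr rfl fun c₁ _ => Finset.sum_comm).trans Finset.sum_comm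

theorem codebookExpectation_eq (f : (Fin M₁ → Fin n → X₁) → (Fin M₂ → Fin n → X₂) → ℝ) :
    codebookExpectation p₁ p₂ f = ∑ c₁ : Fin M₁ → Fin n → X₁, (∏ m, wordProb p₁ (c₁ m)) *
      ∑ c₂ : Fin M₂ → Fin n → X₂, (∏ m, wordProb p₂ (c₂ m)) * f c₁ c₂ := by
  simp only [codebookExpectation, Finset.mul_sum, wordProb, mul_assoc]

theorem codebookExpectation_apply (m₁ : Fin M₁) (m₂ : Fin M₂)
    (g : (Fin n → X₁) → (Fin n → X₂) → ℝ) :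
    codebookExpectation p₁ p₂ (fun c₁ c₂ => g (c₁ m₁) (c₂ m₂)) =
      ∑ x₁, wordProb p₁ x₁ * ∑ x₂, wordProb p₂ x₂ * g x₁ x₂ := by
  rw [codebookExpectation_eq]
  simp only [sum_prod_weights_mul_apply (sum_wordProb p₂) m₂]
  exact sum_prod_weights_mul_apply (sum_wordProb p₁) m₁
    fun x₁ => ∑ x₂, wordProb p₂ x₂ * g x₁ x₂

/-- This and the next two results cover the three ways in which a competing message pair can differ
from the sent one. A shared message means a shared codeword, hence a single argument of `g`. -/
theorem codebookExpectation_apply_of_ne_left {m₁ m₁' : Fin M₁} (h : m₁ ≠ m₁') (m₂ : Fin M₂)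
    (g : (Fin n → X₁) → (Fin n → X₁) → (Fin n → X₂) → ℝ) :
    codebookExpectation p₁ p₂ (fun c₁ c₂ => g (c₁ m₁) (c₁ m₁') (c₂ m₂)) =
      ∑ x₁, ∑ x₁', wordProb p₁ x₁ * wordProb p₁ x₁' * ∑ x₂, wordProb p₂ x₂ * g x₁ x₁' x₂ := by
  rw [codebookExpectation_eq]
  simp only [sum_prod_weights_mul_apply (sum_wordProb p₂) m₂]
  exact sum_prod_weights_mul_apply₂ (sum_wordProb p₁) h
    fun x₁ x₁' => ∑ x₂, wordProb p₂ x₂ * g x₁ x₁' x₂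

theorem codebookExpectation_apply_of_ne_right (m₁ : Fin M₁) {m₂ m₂' : Fin M₂} (h : m₂ ≠ m₂')
    (g : (Fin n → X₁) → (Fin n → X₂) → (Fin n → X₂) → ℝ) :
    codebookExpectation p₁ p₂ (fun c₁ c₂ => g (c₁ m₁) (c₂ m₂) (c₂ m₂')) =
      ∑ x₁, wordProb p₁ x₁ * ∑ x₂, ∑ x₂', wordProb p₂ x₂ * wordProb p₂ x₂' * g x₁ x₂ x₂' := by
  rw [codebookExpectation_eq]
  have := fun c₁ : Fin M₁ → Fin n → X₁ =>
    sum_prod_weights_mul_apply₂ (sum_wordProb p₂) h (g (c₁ m₁))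
  simp only [this]
  exact sum_prod_weights_mul_apply (sum_wordProb p₁) m₁
    fun x₁ => ∑ x₂, ∑ x₂', wordProb p₂ x₂ * wordProb p₂ x₂' * g x₁ x₂ x₂'

theorem codebookExpectation_apply_of_ne {m₁ m₁' : Fin M₁} {m₂ m₂' : Fin M₂} (h₁ : m₁ ≠ m₁')
    (h₂ : m₂ ≠ m₂')
    (g : (Fin n → X₁) → (Fin n → X₁) → (Fin n → X₂) → (Fin n → X₂) → ℝ) :
    codebookExpectation p₁ p₂ (fun c₁ c₂ => g (c₁ m₁) (c₁ m₁') (c₂ m₂) (c₂ m₂')) =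
      ∑ x₁, ∑ x₁', wordProb p₁ x₁ * wordProb p₁ x₁' *
        ∑ x₂, ∑ x₂', wordProb p₂ x₂ * wordProb p₂ x₂' * g x₁ x₁' x₂ x₂' := by
  rw [codebookExpectation_eq]
  have := fun c₁ : Fin M₁ → Fin n → X₁ =>
    sum_prod_weights_mul_apply₂ (sum_wordProb p₂) h₂ (g (c₁ m₁) (c₁ m₁'))
  simp only [this]
  exact sum_prod_weights_mul_apply₂ (sum_wordProb p₁) h₁
    fun x₁ x₁' => ∑ x₂, ∑ x₂', wordProb p₂ x₂ * wordProb p₂ x₂' * g x₁ x₁' x₂ x₂'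

end CodebookExpectation

/-! ### Decoding operators for fixed words -/

section WordSandwich

variable {X₁ X₂ b : Type*} [Fintype X₁] [Fintype X₂] [Fintype b] [DecidableEq b] {n : ℕ}
  (p₁ : stdSimplex ℝ X₁) (p₂ : stdSimplex ℝ X₂) (ρ : X₁ → X₂ → DensityMatrix b) (η : ℝ)

/-- The output of `n` uses of the channel on a pair of words. -/
def outputState (x₁ : Fin n → X₁) (x₂ : Fin n → X₂) : Matrix (Fin n → b) (Fin n → b) ℂ :=
  tensorState fun i => ρ (x₁ i) (x₂ i)

/-- The state `ρ̄_{x₁}`. -/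
def averageRight (x₁ : X₁) : DensityMatrix b :=
  DensityMatrix.average p₂ (ρ x₁)

/-- The state `ρ̄_{x₂}`. -/
def averageLeft (x₂ : X₂) : DensityMatrix b :=
  DensityMatrix.average p₁ fun x₁ => ρ x₁ x₂

/-- The state `ρ̄`. -/
def averageBoth : DensityMatrix b :=
  DensityMatrix.average p₁ (averageRight p₂ ρ)

/-- The conditional entropy `H(B|X₁X₂)`. -/
def condEntropyBoth : ℝ :=
  ∑ q : X₁ × X₂, p₁ q.1 * p₂ q.2 * entropy (ρ q.1 q.2).mat

/-- The conditional entropy `H(B|X₁)`. -/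
def condEntropyLeft : ℝ :=
  ∑ x₁, p₁ x₁ * entropy (averageRight p₂ ρ x₁).mat

/-- The conditional entropy `H(B|X₂)`. -/
def condEntropyRight : ℝ :=
  ∑ x₂, p₂ x₂ * entropy (averageLeft p₁ ρ x₂).mat

/-- The projector `Π_{m₁}` of the decoder, for a word. -/
def projectorLeft (x₁ : Fin n → X₁) : Matrix (Fin n → b) (Fin n → b) ℂ :=
  condTypicalProjector p₁ (averageRight p₂ ρ) η x₁

/-- The conditionally typical projector for a word of the second sender. -/
def projectorRight (x₂ : Fin n → X₂) : Matrix (Fin n → b) (Fin n → b) ℂ :=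
  condTypicalProjector p₂ (averageLeft p₁ ρ) η x₂

/-- The projector `Π_{m₁,m₂}` of the decoder, for a pair of words. -/
def projectorBoth (x₁ : Fin n → X₁) (x₂ : Fin n → X₂) : Matrix (Fin n → b) (Fin n → b) ℂ :=
  condTypicalProjector (fun q : X₁ × X₂ => p₁ q.1 * p₂ q.2) (fun q => ρ q.1 q.2) η
    fun i => (x₁ i, x₂ i)

/-- The operator of the decoder for a pair of words. -/
def wordSandwich (x₁ : Fin n → X₁) (x₂ : Fin n → X₂) : Matrix (Fin n → b) (Fin n → b) ℂ :=
  typicalProjector (averageBoth p₁ p₂ ρ) η n * projectorLeft p₁ p₂ ρ η x₁ *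
    projectorBoth p₁ p₂ ρ η x₁ x₂ * projectorLeft p₁ p₂ ρ η x₁ *
    typicalProjector (averageBoth p₁ p₂ ρ) η n

theorem isStarProjection_typicalProjector :
    IsStarProjection (typicalProjector (averageBoth p₁ p₂ ρ) η n) :=
  isStarProjection_projector _ _ _

theorem isStarProjection_projectorLeft (x₁ : Fin n → X₁) :
    IsStarProjection (projectorLeft p₁ p₂ ρ η x₁) :=
  isStarProjection_projector _ _ _

theorem isStarProjection_projectorRight (x₂ : Fin n → X₂) :
    IsStarProjection (projectorRight p₁ p₂ ρ η x₂) :=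
  isStarProjection_projector _ _ _

theorem isStarProjection_projectorBoth (x₁ : Fin n → X₁) (x₂ : Fin n → X₂) :
    IsStarProjection (projectorBoth p₁ p₂ ρ η x₁ x₂) :=
  isStarProjection_projector _ _ _

theorem wordSandwich_nonneg (x₁ : Fin n → X₁) (x₂ : Fin n → X₂) :
    0 ≤ wordSandwich p₁ p₂ ρ η x₁ x₂ :=
  sandwich_nonneg (isStarProjection_typicalProjector ..) (isStarProjection_projectorLeft ..)
    (isStarProjection_projectorBoth ..).nonneg

theorem wordSandwich_le_one (x₁ : Fin n → X₁) (x₂ : Fin n → X₂) :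
    wordSandwich p₁ p₂ ρ η x₁ x₂ ≤ 1 :=
  sandwich_le_one (isStarProjection_typicalProjector ..) (isStarProjection_projectorLeft ..)
    (isStarProjection_projectorBoth ..).le_one

theorem outputState_nonneg (x₁ : Fin n → X₁) (x₂ : Fin n → X₂) : 0 ≤ outputState ρ x₁ x₂ :=
  tensorState_nonneg _

theorem trace_outputState (x₁ : Fin n → X₁) (x₂ : Fin n → X₂) :
    (outputState ρ x₁ x₂).trace = 1 :=
  trace_tensorState _

theorem sum_wordProb_smul_outputState_left (x₂ : Fin n → X₂) :
    ∑ x₁, wordProb p₁ x₁ • outputState ρ x₁ x₂ = tensorState fun i => averageLeft p₁ ρ (x₂ i) :=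
  sum_smul_tensorState p₁ fun i x₁ => ρ x₁ (x₂ i)

theorem sum_wordProb_smul_outputState_right (x₁ : Fin n → X₁) :
    ∑ x₂, wordProb p₂ x₂ • outputState ρ x₁ x₂ = tensorState fun i => averageRight p₂ ρ (x₁ i) :=
  sum_smul_tensorState p₂ fun i x₂ => ρ (x₁ i) x₂

theorem sum_wordProb_smul_averageRight :
    ∑ x₁ : Fin n → X₁, wordProb p₁ x₁ • tensorState (fun i => averageRight p₂ ρ (x₁ i)) =
      tensorState fun _ => averageBoth p₁ p₂ ρ :=
  sum_smul_tensorState p₁ fun _ x₁ => averageRight p₂ ρ x₁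

theorem sum_wordProb_mul_trace {X : Type*} [Fintype X] (p : stdSimplex ℝ X)
    (D : Matrix (Fin n → b) (Fin n → b) ℂ) (s : (Fin n → X) → Matrix (Fin n → b) (Fin n → b) ℂ) :
    ∑ x, wordProb p x * (D * s x).trace.re = (D * ∑ x, wordProb p x • s x).trace.re := by
  simp [Finset.mul_sum, Matrix.trace_sum]

section MissedDetection

variable {η} {ε : ℝ}

/-- The projector depends on neither word, so averaging replaces the output by `ρ̄^{⊗n}`. -/
theorem exists_forall_typicalProjector_average_le (hη : 0 < η) (hε : 0 < ε) :
    ∃ N : ℕ, ∀ n : ℕ, N ≤ n → ∑ x₁ : Fin n → X₁, wordProb p₁ x₁ * ∑ x₂, wordProb p₂ x₂ *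
      ((1 - typicalProjector (averageBoth p₁ p₂ ρ) η n) * outputState ρ x₁ x₂).trace.re ≤ ε := by
  obtain ⟨N, hN⟩ := exists_forall_typicalProjector_le (averageBoth p₁ p₂ ρ) hη hε
  refine ⟨N, fun n hn => ?_⟩
  simp only [sum_wordProb_mul_trace, sum_wordProb_smul_outputState_right,
    sum_wordProb_smul_averageRight]
  exact hN n hn

theorem exists_forall_projectorLeft_le (hη : 0 < η) (hε : 0 < ε) :
    ∃ N : ℕ, ∀ n : ℕ, N ≤ n → ∑ x₁ : Fin n → X₁, wordProb p₁ x₁ * ∑ x₂, wordProb p₂ x₂ *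
      ((1 - projectorLeft p₁ p₂ ρ η x₁) * outputState ρ x₁ x₂).trace.re ≤ ε := by
  obtain ⟨N, hN⟩ := exists_forall_condTypicalProjector_le p₁.2.1 p₁.2.2 (averageRight p₂ ρ) hη hε
  refine ⟨N, fun n hn => ?_⟩
  simp only [sum_wordProb_mul_trace, sum_wordProb_smul_outputState_right]
  exact hN n hn

/-- This projector is not in the decoder; the estimate pays for inserting it in the analysis. -/
theorem exists_forall_projectorRight_le (hη : 0 < η) (hε : 0 < ε) :
    ∃ N : ℕ, ∀ n : ℕ, N ≤ n → ∑ x₁ : Fin n → X₁, wordProb p₁ x₁ * ∑ x₂, wordProb p₂ x₂ *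
      ((1 - projectorRight p₁ p₂ ρ η x₂) * outputState ρ x₁ x₂).trace.re ≤ ε := by
  obtain ⟨N, hN⟩ := exists_forall_condTypicalProjector_le p₂.2.1 p₂.2.2 (averageLeft p₁ ρ) hη hε
  refine ⟨N, fun n hn => le_of_eq_of_le ?_ (hN n hn)⟩
  have e : ∀ (x₁ : Fin n → X₁) (x₂ : Fin n → X₂), wordProb p₁ x₁ * (wordProb p₂ x₂ *
      ((1 - projectorRight p₁ p₂ ρ η x₂) * outputState ρ x₁ x₂).trace.re) =
      wordProb p₂ x₂ * (wordProb p₁ x₁ *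
        ((1 - projectorRight p₁ p₂ ρ η x₂) * outputState ρ x₁ x₂).trace.re) :=
    fun _ _ => mul_left_comm _ _ _
  simp only [Finset.mul_sum, e]
  rw [Finset.sum_comm]
  simp only [← Finset.mul_sum, sum_wordProb_mul_trace, sum_wordProb_smul_outputState_left]
  rfl

theorem exists_forall_projectorBoth_le (hη : 0 < η) (hε : 0 < ε) :
    ∃ N : ℕ, ∀ n : ℕ, N ≤ n → ∑ x₁ : Fin n → X₁, wordProb p₁ x₁ * ∑ x₂, wordProb p₂ x₂ *
      ((1 - projectorBoth p₁ p₂ ρ η x₁ x₂) * outputState ρ x₁ x₂).trace.re ≤ ε := by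
  have hp : ∑ q : X₁ × X₂, p₁ q.1 * p₂ q.2 = 1 := by
    have h₁ : ∑ x, p₁ x = 1 := p₁.2.2
    have h₂ : ∑ x, p₂ x = 1 := p₂.2.2
    simp [Fintype.sum_prod_type, ← Finset.mul_sum, h₁, h₂]
  obtain ⟨N, hN⟩ := exists_forall_condTypicalProjector_le
    (fun q : X₁ × X₂ => mul_nonneg (p₁.2.1 q.1) (p₂.2.1 q.2)) hp (fun q => ρ q.1 q.2) hη hε
  refine ⟨N, fun n hn => le_of_eq_of_le ?_ (hN n hn)⟩
  rw [← (Equiv.arrowProdEquivProdArrow (Fin n) (fun _ => X₁) (fun _ => X₂)).symm.sum_comp,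
    Fintype.sum_prod_type]
  simp only [Finset.mul_sum, ← mul_assoc]
  refine Finset.sum_congr rfl fun x₁ _ => Finset.sum_congr rfl fun x₂ _ => ?_
  simp only [wordProb, ← Finset.prod_mul_distrib]
  rfl

end MissedDetection

/-! ### Size of the decoding operators and of their averages -/

section FalseDetection

variable {η}

theorem projectorBoth_le (hn : 0 < n) (x₁ : Fin n → X₁) (x₂ : Fin n → X₂) :
    projectorBoth p₁ p₂ ρ η x₁ x₂ ≤
      (2 : ℝ) ^ (n * (condEntropyBoth p₁ p₂ ρ + η)) • outputState ρ x₁ x₂ :=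
  projector_le_smul_tensorState _ _ _ hn

theorem trace_wordSandwich_le (hn : 0 < n) (x₁ : Fin n → X₁) (x₂ : Fin n → X₂) :
    (wordSandwich p₁ p₂ ρ η x₁ x₂).trace.re ≤
      (2 : ℝ) ^ (n * (condEntropyBoth p₁ p₂ ρ + η)) := by
  have hA := isStarProjection_typicalProjector (n := n) p₁ p₂ ρ η
  have hB := isStarProjection_projectorLeft p₁ p₂ ρ η x₁
  have hC := (isStarProjection_projectorBoth p₁ p₂ ρ η x₁ x₂).nonneg
  have h1 := trace_conj_le hA (hB.conj_nonneg hC)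
  have h2 := trace_conj_le hB hC
  have h3 := trace_mul_le_trace_mul (projectorBoth_le p₁ p₂ ρ (η := η) hn x₁ x₂) zero_le_one
  rw [mul_one, mul_one, Matrix.trace_smul, trace_outputState] at h3
  have e : (((2 : ℝ) ^ (n * (condEntropyBoth p₁ p₂ ρ + η))) • (1 : ℂ)).re =
      (2 : ℝ) ^ (n * (condEntropyBoth p₁ p₂ ρ + η)) := by simp
  rw [e] at h3
  refine le_trans ?_ (h1.trans (h2.trans h3))
  simp only [wordSandwich, mul_assoc, le_refl]

/-- The average of the decoding operators over the words of the second sender. -/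
theorem sum_wordProb_smul_wordSandwich_le (hn : 0 < n) (x₁ : Fin n → X₁) :
    ∑ x₂, wordProb p₂ x₂ • wordSandwich p₁ p₂ ρ η x₁ x₂ ≤
      (2 : ℝ) ^ (n * (condEntropyBoth p₁ p₂ ρ + η)) •
        (typicalProjector (averageBoth p₁ p₂ ρ) η n *
          (projectorLeft p₁ p₂ ρ η x₁ * tensorState (fun i => averageRight p₂ ρ (x₁ i)) *
            projectorLeft p₁ p₂ ρ η x₁) * typicalProjector (averageBoth p₁ p₂ ρ) η n) := by
  have hA := isStarProjection_typicalProjector (n := n) p₁ p₂ ρ η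
  have hB := isStarProjection_projectorLeft p₁ p₂ ρ η x₁
  have h : ∑ x₂, wordProb p₂ x₂ • projectorBoth p₁ p₂ ρ η x₁ x₂ ≤
      (2 : ℝ) ^ (n * (condEntropyBoth p₁ p₂ ρ + η)) •
        tensorState fun i => averageRight p₂ ρ (x₁ i) := by
    rw [← sum_wordProb_smul_outputState_right, Finset.smul_sum]
    refine Finset.sum_le_sum fun x₂ _ => ?_
    rw [smul_comm]
    exact smul_le_smul_of_nonneg_left (projectorBoth_le p₁ p₂ ρ hn x₁ x₂) (wordProb_nonneg p₂ x₂)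
  have h2 := hA.conj_le_conj (hB.conj_le_conj h)
  simpa only [wordSandwich, mul_assoc, Finset.mul_sum, Finset.sum_mul, Matrix.mul_smul,
    Matrix.smul_mul] using h2

/-- Here `Π_{m₁}` does the flattening, and the outer projector is merely bounded by `1`. -/
theorem sum_wordProb_smul_wordSandwich_le_smul_one (hn : 0 < n) (x₁ : Fin n → X₁) :
    ∑ x₂, wordProb p₂ x₂ • wordSandwich p₁ p₂ ρ η x₁ x₂ ≤
      ((2 : ℝ) ^ (n * (condEntropyBoth p₁ p₂ ρ + η)) *
        (2 : ℝ) ^ (-(n * (condEntropyLeft p₁ p₂ ρ - η)))) •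
          (1 : Matrix (Fin n → b) (Fin n → b) ℂ) := by
  have hA := isStarProjection_typicalProjector (n := n) p₁ p₂ ρ η
  refine (sum_wordProb_smul_wordSandwich_le p₁ p₂ ρ hn x₁).trans ?_
  rw [mul_smul]
  refine smul_le_smul_of_nonneg_left ?_ (by positivity)
  have h := hA.conj_le_conj (projector_conj_tensorState_le
    (fun i => averageRight p₂ ρ (x₁ i)) (condEntropyLeft p₁ p₂ ρ) η hn)
  refine h.trans ?_
  rw [Matrix.mul_smul, Matrix.smul_mul, mul_one, hA.isIdempotentElem.eq]
  exact smul_le_smul_of_nonneg_left hA.le_one (by positivity)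

/-- Now `Π_{m₁}` has to disappear before averaging over `x₁`. It commutes with the state of `x₁`, so
dropping it only increases the operator; then `Π_ρ̄` flattens `ρ̄^{⊗n}`. -/
theorem sum_sum_wordProb_smul_wordSandwich_le_smul_one (hn : 0 < n) :
    ∑ x₁ : Fin n → X₁, wordProb p₁ x₁ • ∑ x₂, wordProb p₂ x₂ • wordSandwich p₁ p₂ ρ η x₁ x₂ ≤
      ((2 : ℝ) ^ (n * (condEntropyBoth p₁ p₂ ρ + η)) *
        (2 : ℝ) ^ (-(n * (entropy (averageBoth p₁ p₂ ρ).mat - η)))) •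
          (1 : Matrix (Fin n → b) (Fin n → b) ℂ) := by
  have hA := isStarProjection_typicalProjector (n := n) p₁ p₂ ρ η
  have h : ∀ x₁ : Fin n → X₁, ∑ x₂, wordProb p₂ x₂ • wordSandwich p₁ p₂ ρ η x₁ x₂ ≤
      (2 : ℝ) ^ (n * (condEntropyBoth p₁ p₂ ρ + η)) •
        (typicalProjector (averageBoth p₁ p₂ ρ) η n *
          tensorState (fun i => averageRight p₂ ρ (x₁ i)) *
            typicalProjector (averageBoth p₁ p₂ ρ) η n) := fun x₁ =>
    (sum_wordProb_smul_wordSandwich_le p₁ p₂ ρ hn x₁).trans <|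
      smul_le_smul_of_nonneg_left
        (hA.conj_le_conj (projector_conj_tensorState_le_self _ _ _)) (by positivity)
  refine (Finset.sum_le_sum fun x₁ _ =>
    smul_le_smul_of_nonneg_left (h x₁) (wordProb_nonneg p₁ x₁)).trans ?_
  simp only [smul_comm (wordProb p₁ _), ← Finset.smul_sum]
  rw [mul_smul]
  refine smul_le_smul_of_nonneg_left ?_ (by positivity)
  have h2 := projector_conj_tensorState_le (fun _ : Fin n => averageBoth p₁ p₂ ρ)
    (entropy (averageBoth p₁ p₂ ρ).mat) η hn
  rw [← sum_wordProb_smul_averageRight] at h2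
  simp only [Finset.mul_sum, Finset.sum_mul, Matrix.mul_smul, Matrix.smul_mul] at h2
  exact h2

end FalseDetection

/-! ### The three kinds of false detection -/

/-- The weight that the decoding operator of the pair `x₁'`, `x₂'` gives to the output for
the pair `x₁`, `x₂`, cut down by the typical projector of `x₂`. -/
def crossTerm (x₁ x₁' : Fin n → X₁) (x₂ x₂' : Fin n → X₂) : ℝ :=
  (projectorRight p₁ p₂ ρ η x₂ * wordSandwich p₁ p₂ ρ η x₁' x₂' * projectorRight p₁ p₂ ρ η x₂ *
    outputState ρ x₁ x₂).trace.re

variable {η}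

theorem trace_conj_mul_outputState_le {r : ℝ} (hr : 0 ≤ r)
    {D : Matrix (Fin n → b) (Fin n → b) ℂ} (hD : D ≤ r • 1) (x₁ : Fin n → X₁) (x₂ : Fin n → X₂) :
    (projectorRight p₁ p₂ ρ η x₂ * D * projectorRight p₁ p₂ ρ η x₂ *
      outputState ρ x₁ x₂).trace.re ≤ r := by
  have hQ := isStarProjection_projectorRight p₁ p₂ ρ η x₂
  have h := hQ.conj_le_conj hD
  rw [Matrix.mul_smul, Matrix.smul_mul, mul_one, hQ.isIdempotentElem.eq] at h
  have h2 := trace_mul_le_trace_mul (h.trans (smul_le_smul_of_nonneg_left hQ.le_one hr))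
    (outputState_nonneg ρ x₁ x₂)
  rw [Matrix.smul_mul, one_mul, Matrix.trace_smul, trace_outputState] at h2
  simpa using h2

/-- Here the state is averaged, not the decoding operator: `x₁` does not enter the competing
operator, so its average gives the state of `x₂`. The inserted projector flattens that state, and
the trace bound on the sandwich supplies the other factor. -/
theorem sum_crossTerm_left_le (hn : 0 < n) :
    ∑ x₁ : Fin n → X₁, ∑ x₁', wordProb p₁ x₁ * wordProb p₁ x₁' *
      ∑ x₂, wordProb p₂ x₂ * crossTerm p₁ p₂ ρ η x₁ x₁' x₂ x₂ ≤
      (2 : ℝ) ^ (n * (condEntropyBoth p₁ p₂ ρ + η)) *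
        (2 : ℝ) ^ (-(n * (condEntropyRight p₁ p₂ ρ - η))) := by
  set r := (2 : ℝ) ^ (n * (condEntropyBoth p₁ p₂ ρ + η)) *
        (2 : ℝ) ^ (-(n * (condEntropyRight p₁ p₂ ρ - η))) with hr
  have h : ∀ (x₁' : Fin n → X₁) (x₂ : Fin n → X₂),
      ∑ x₁, wordProb p₁ x₁ * crossTerm p₁ p₂ ρ η x₁ x₁' x₂ x₂ ≤ r := by
    intro x₁' x₂
    have hP := wordSandwich_nonneg p₁ p₂ ρ η x₁' x₂
    have h1 := trace_mul_le_trace_mul (projector_conj_tensorState_le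
      (fun i => averageLeft p₁ ρ (x₂ i)) (condEntropyRight p₁ p₂ ρ) η hn) hP
    rw [Matrix.smul_mul, one_mul, Matrix.trace_smul, Complex.smul_re, smul_eq_mul] at h1
    simp only [crossTerm, sum_wordProb_mul_trace, sum_wordProb_smul_outputState_left]
    have e : (projectorRight p₁ p₂ ρ η x₂ * wordSandwich p₁ p₂ ρ η x₁' x₂ *
        projectorRight p₁ p₂ ρ η x₂ * tensorState fun i => averageLeft p₁ ρ (x₂ i)).trace =
        (projectorRight p₁ p₂ ρ η x₂ * tensorState (fun i => averageLeft p₁ ρ (x₂ i)) *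
          projectorRight p₁ p₂ ρ η x₂ * wordSandwich p₁ p₂ ρ η x₁' x₂).trace := by
      -- Cyclicity moves the two projectors from the decoding operator to the state.
      rw [mul_assoc (_ * _), Matrix.trace_mul_comm]
      simp only [mul_assoc]
    rw [e]
    refine h1.trans ?_
    rw [hr, mul_comm]
    exact mul_le_mul_of_nonneg_right (trace_wordSandwich_le p₁ p₂ ρ hn x₁' x₂) (by positivity)
  calc _ = ∑ x₁' : Fin n → X₁, wordProb p₁ x₁' * ∑ x₂, wordProb p₂ x₂ *
        ∑ x₁, wordProb p₁ x₁ * crossTerm p₁ p₂ ρ η x₁ x₁' x₂ x₂ := by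
        simp only [Finset.mul_sum]
        rw [Finset.sum_comm]
        refine Finset.sum_congr rfl fun x₁' _ => ?_
        rw [Finset.sum_comm]
        exact Finset.sum_congr rfl fun x₂ _ => Finset.sum_congr rfl fun x₁ _ => by ring
    _ ≤ ∑ x₁' : Fin n → X₁, wordProb p₁ x₁' * ∑ x₂ : Fin n → X₂, wordProb p₂ x₂ * r := by
        gcongr with x₁' _ x₂ _
        · exact wordProb_nonneg _ _
        · exact wordProb_nonneg _ _
        · exact h _ _
    _ = r := by simp only [sum_wordProb_mul_const]

theorem sum_wordProb_mul_trace_conj {X : Type*} [Fintype X] (p : stdSimplex ℝ X)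
    (D E : Matrix (Fin n → b) (Fin n → b) ℂ)
    (s : (Fin n → X) → Matrix (Fin n → b) (Fin n → b) ℂ) :
    ∑ x, wordProb p x * (D * s x * D * E).trace.re =
      (D * (∑ x, wordProb p x • s x) * D * E).trace.re := by
  simp [Finset.mul_sum, Finset.sum_mul, Matrix.trace_sum]

/-- The output does not depend on `x₂'`, so the competing operator can be averaged first. Its bound
by a multiple of `1` survives the inserted projector. -/
theorem sum_crossTerm_right_le (hn : 0 < n) :
    ∑ x₁ : Fin n → X₁, wordProb p₁ x₁ * ∑ x₂, ∑ x₂', wordProb p₂ x₂ * wordProb p₂ x₂' *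
      crossTerm p₁ p₂ ρ η x₁ x₁ x₂ x₂' ≤
      (2 : ℝ) ^ (n * (condEntropyBoth p₁ p₂ ρ + η)) *
        (2 : ℝ) ^ (-(n * (condEntropyLeft p₁ p₂ ρ - η))) := by
  set r := (2 : ℝ) ^ (n * (condEntropyBoth p₁ p₂ ρ + η)) *
        (2 : ℝ) ^ (-(n * (condEntropyLeft p₁ p₂ ρ - η))) with hr
  have h : ∀ (x₁ : Fin n → X₁) (x₂ : Fin n → X₂),
      ∑ x₂', wordProb p₂ x₂' * crossTerm p₁ p₂ ρ η x₁ x₁ x₂ x₂' ≤ r := by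
    intro x₁ x₂
    simp only [crossTerm, sum_wordProb_mul_trace_conj]
    exact trace_conj_mul_outputState_le p₁ p₂ ρ (by positivity)
      (sum_wordProb_smul_wordSandwich_le_smul_one p₁ p₂ ρ hn x₁) x₁ x₂
  calc _ = ∑ x₁ : Fin n → X₁, wordProb p₁ x₁ * ∑ x₂, wordProb p₂ x₂ *
        ∑ x₂', wordProb p₂ x₂' * crossTerm p₁ p₂ ρ η x₁ x₁ x₂ x₂' := by
        simp only [Finset.mul_sum, mul_assoc]
    _ ≤ ∑ x₁ : Fin n → X₁, wordProb p₁ x₁ * ∑ x₂ : Fin n → X₂, wordProb p₂ x₂ * r := by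
        gcongr with x₁ _ x₂ _
        · exact wordProb_nonneg _ _
        · exact wordProb_nonneg _ _
        · exact h _ _
    _ = r := by simp only [sum_wordProb_mul_const]

theorem sum_crossTerm_both_le (hn : 0 < n) :
    ∑ x₁ : Fin n → X₁, ∑ x₁', wordProb p₁ x₁ * wordProb p₁ x₁' *
      ∑ x₂, ∑ x₂', wordProb p₂ x₂ * wordProb p₂ x₂' * crossTerm p₁ p₂ ρ η x₁ x₁' x₂ x₂' ≤
      (2 : ℝ) ^ (n * (condEntropyBoth p₁ p₂ ρ + η)) *
        (2 : ℝ) ^ (-(n * (entropy (averageBoth p₁ p₂ ρ).mat - η))) := by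
  set r := (2 : ℝ) ^ (n * (condEntropyBoth p₁ p₂ ρ + η)) *
        (2 : ℝ) ^ (-(n * (entropy (averageBoth p₁ p₂ ρ).mat - η))) with hr
  have h : ∀ (x₁ : Fin n → X₁) (x₂ : Fin n → X₂), ∑ x₁', wordProb p₁ x₁' *
      ∑ x₂', wordProb p₂ x₂' * crossTerm p₁ p₂ ρ η x₁ x₁' x₂ x₂' ≤ r := by
    intro x₁ x₂
    simp only [crossTerm, sum_wordProb_mul_trace_conj]
    exact trace_conj_mul_outputState_le p₁ p₂ ρ (by positivity)
      (sum_sum_wordProb_smul_wordSandwich_le_smul_one p₁ p₂ ρ hn) x₁ x₂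
  calc _ = ∑ x₁ : Fin n → X₁, wordProb p₁ x₁ * ∑ x₂, wordProb p₂ x₂ *
        ∑ x₁', wordProb p₁ x₁' * ∑ x₂', wordProb p₂ x₂' *
          crossTerm p₁ p₂ ρ η x₁ x₁' x₂ x₂' := by
        simp only [Finset.mul_sum]
        refine Finset.sum_congr rfl fun x₁ _ => ?_
        rw [Finset.sum_comm]
        exact Finset.sum_congr rfl fun x₂ _ => Finset.sum_congr rfl fun x₁' _ =>
          Finset.sum_congr rfl fun x₂' _ => by ring
    _ ≤ ∑ x₁ : Fin n → X₁, wordProb p₁ x₁ * ∑ x₂ : Fin n → X₂, wordProb p₂ x₂ * r := by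
        gcongr with x₁ _ x₂ _
        · exact wordProb_nonneg _ _
        · exact wordProb_nonneg _ _
        · exact h _ _
    _ = r := by simp only [sum_wordProb_mul_const]

end WordSandwich

/-! ### Error bound for the random code -/

section ErrorBound

variable {X₁ X₂ b : Type*} [Fintype X₁] [Fintype X₂] [Fintype b] [DecidableEq b] {n M₁ M₂ : ℕ}
  (p₁ : stdSimplex ℝ X₁) (p₂ : stdSimplex ℝ X₂) (ρ : X₁ → X₂ → DensityMatrix b) (η : ℝ)

theorem sandwich_eq (c₁ : Fin M₁ → Fin n → X₁) (c₂ : Fin M₂ → Fin n → X₂)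
    (m : Fin M₁ × Fin M₂) :
    sandwich p₁ p₂ ρ η c₁ c₂ m = wordSandwich p₁ p₂ ρ η (c₁ m.1) (c₂ m.2) := rfl

/-- The error probability of one message pair, for a fixed code. -/
theorem trace_one_sub_squareRootOp_le (c₁ : Fin M₁ → Fin n → X₁) (c₂ : Fin M₂ → Fin n → X₂)
    (m : Fin M₁ × Fin M₂) :
    ((1 - squareRootOp (sandwich p₁ p₂ ρ η c₁ c₂) m) *
        outputState ρ (c₁ m.1) (c₂ m.2)).trace.re ≤
      88 * ((1 - typicalProjector (averageBoth p₁ p₂ ρ) η n) *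
          outputState ρ (c₁ m.1) (c₂ m.2)).trace.re +
      48 * ((1 - projectorLeft p₁ p₂ ρ η (c₁ m.1)) * outputState ρ (c₁ m.1) (c₂ m.2)).trace.re +
      32 * ((1 - projectorBoth p₁ p₂ ρ η (c₁ m.1) (c₂ m.2)) *
          outputState ρ (c₁ m.1) (c₂ m.2)).trace.re +
      10 * ((1 - projectorRight p₁ p₂ ρ η (c₂ m.2)) * outputState ρ (c₁ m.1) (c₂ m.2)).trace.re +
      8 * ∑ j ∈ Finset.univ.erase m,
        crossTerm p₁ p₂ ρ η (c₁ m.1) (c₁ j.1) (c₂ m.2) (c₂ j.2) := by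
  have h1 := one_sub_squareRootOp_le (P := sandwich p₁ p₂ ρ η c₁ c₂)
    (fun k => wordSandwich_nonneg ..) (fun k => wordSandwich_le_one ..) m
    (isStarProjection_projectorRight p₁ p₂ ρ η (c₂ m.2))
  have h2 := one_sub_sandwich_le (isStarProjection_typicalProjector (n := n) p₁ p₂ ρ η)
    (isStarProjection_projectorLeft p₁ p₂ ρ η (c₁ m.1))
    (isStarProjection_projectorBoth p₁ p₂ ρ η (c₁ m.1) (c₂ m.2))
  have hω := outputState_nonneg ρ (c₁ m.1) (c₂ m.2)
  have h3 := trace_mul_le_trace_mul h1 hω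
  have h4 := trace_mul_le_trace_mul h2 hω
  simp only [add_mul, Matrix.smul_mul, Matrix.trace_add, Matrix.trace_smul, Complex.add_re,
    Complex.smul_re, smul_eq_mul, Finset.sum_mul, Matrix.trace_sum, Complex.re_sum] at h3 h4
  rw [sandwich_eq, wordSandwich] at h3
  simp only [crossTerm, ← sandwich_eq p₁ p₂ ρ η c₁ c₂]
  linarith

theorem codebookExpectation_avgError_le {κ : ℝ} (hM₁ : 0 < M₁) (hM₂ : 0 < M₂)
    (Λ : (Fin M₁ → Fin n → X₁) → (Fin M₂ → Fin n → X₂) →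
      Fin M₁ × Fin M₂ → Matrix (Fin n → b) (Fin n → b) ℂ)
    (h : ∀ m : Fin M₁ × Fin M₂, codebookExpectation p₁ p₂ (fun c₁ c₂ =>
      ((1 - Λ c₁ c₂ m) * outputState ρ (c₁ m.1) (c₂ m.2)).trace.re) ≤ κ) :
    codebookExpectation p₁ p₂ (fun c₁ c₂ => avgError ρ c₁ c₂ (Λ c₁ c₂)) ≤ κ := by
  have hM : (0 : ℝ) < M₁ * M₂ := by positivity
  simp only [avgError]
  rw [codebookExpectation_const_mul, codebookExpectation_sum, one_div,
    inv_mul_le_iff₀ hM]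
  refine (Finset.sum_le_sum fun m _ => h m).trans_eq ?_
  simp

theorem sum_fin_ite {M : ℕ} (a : Fin M) (u v : ℝ) :
    ∑ j : Fin M, (if j = a then u else v) = u + (M - 1) * v := by
  have hM : 1 ≤ M := a.pos
  rw [← Finset.add_sum_erase _ _ (Finset.mem_univ a), if_pos rfl,
    Finset.sum_congr rfl fun j hj => if_neg (Finset.ne_of_mem_erase hj)]
  simp [Finset.card_erase_of_mem, Nat.cast_sub hM]

theorem sum_codebookExpectation_crossTerm_le (hn : 0 < n) (m : Fin M₁ × Fin M₂) {β₁ β₂ β₃ : ℝ}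
    (h₁ : (2 : ℝ) ^ (n * (condEntropyBoth p₁ p₂ ρ + η)) *
        (2 : ℝ) ^ (-(n * (condEntropyRight p₁ p₂ ρ - η))) ≤ β₁)
    (h₂ : (2 : ℝ) ^ (n * (condEntropyBoth p₁ p₂ ρ + η)) *
        (2 : ℝ) ^ (-(n * (condEntropyLeft p₁ p₂ ρ - η))) ≤ β₂)
    (h₃ : (2 : ℝ) ^ (n * (condEntropyBoth p₁ p₂ ρ + η)) *
        (2 : ℝ) ^ (-(n * (entropy (averageBoth p₁ p₂ ρ).mat - η))) ≤ β₃) :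
    ∑ j ∈ Finset.univ.erase m, codebookExpectation (n := n) p₁ p₂ (fun c₁ c₂ =>
        crossTerm p₁ p₂ ρ η (c₁ m.1) (c₁ j.1) (c₂ m.2) (c₂ j.2)) ≤
      (M₁ - 1) * β₁ + (M₂ - 1) * β₂ + (M₁ - 1) * (M₂ - 1) * β₃ := by
  have h : ∀ j ∈ Finset.univ.erase m, codebookExpectation (n := n) p₁ p₂ (fun c₁ c₂ =>
      crossTerm p₁ p₂ ρ η (c₁ m.1) (c₁ j.1) (c₂ m.2) (c₂ j.2)) ≤
      -- The value `0` at `j = m` lets the sum be extended to all pairs and evaluated one index at a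
      -- time.
      if j.1 = m.1 then (if j.2 = m.2 then 0 else β₂) else (if j.2 = m.2 then β₁ else β₃) := by
    rintro ⟨j₁, j₂⟩ hj
    obtain ⟨m₁, m₂⟩ := m
    have hj : ¬(j₁ = m₁ ∧ j₂ = m₂) := by simpa using hj
    dsimp only
    split_ifs with e₁ e₂ e₂
    · exact absurd ⟨e₁, e₂⟩ hj
    · subst e₁
      rw [codebookExpectation_apply_of_ne_right p₁ p₂ j₁ (Ne.symm e₂)
        fun x₁ x₂ x₂' => crossTerm p₁ p₂ ρ η x₁ x₁ x₂ x₂']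
      exact (sum_crossTerm_right_le p₁ p₂ ρ hn).trans h₂
    · subst e₂
      rw [codebookExpectation_apply_of_ne_left p₁ p₂ (Ne.symm e₁) j₂
        fun x₁ x₁' x₂ => crossTerm p₁ p₂ ρ η x₁ x₁' x₂ x₂]
      exact (sum_crossTerm_left_le p₁ p₂ ρ hn).trans h₁
    · rw [codebookExpectation_apply_of_ne p₁ p₂ (Ne.symm e₁) (Ne.symm e₂)
        fun x₁ x₁' x₂ x₂' => crossTerm p₁ p₂ ρ η x₁ x₁' x₂ x₂']
      exact (sum_crossTerm_both_le p₁ p₂ ρ hn).trans h₃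
  refine (Finset.sum_le_sum h).trans (le_of_eq ?_)
  rw [Finset.sum_erase _ (by simp), Fintype.sum_prod_type]
  have e : ∀ j₁ : Fin M₁, (∑ j₂ : Fin M₂, if j₁ = m.1 then (if j₂ = m.2 then 0 else β₂)
      else (if j₂ = m.2 then β₁ else β₃)) =
      if j₁ = m.1 then (M₂ - 1) * β₂ else β₁ + (M₂ - 1) * β₃ := by
    intro j₁
    split_ifs
    · rw [sum_fin_ite, zero_add]
    · rw [sum_fin_ite]
  simp only [e]
  rw [sum_fin_ite]
  ring

/-- Only the `M - 1` competitors count, so rounding up costs nothing. For `r ≤ 1`, in particular for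
a negative exponent, there is no competitor. -/
theorem cast_sub_one_le {M : ℕ} {r : ℝ} (hr : 0 ≤ r) (h : M ≤ ⌈r⌉₊) : (M : ℝ) - 1 ≤ r := by
  have h1 : (M : ℝ) ≤ ⌈r⌉₊ := by exact_mod_cast h
  have := Nat.ceil_lt_add_one hr
  linarith

/-- The rate conditions make the false detections exponentially unlikely. -/
theorem rate_bound {H₁₂ H₁ H₂ H₀ R₁ R₂ δ : ℝ} {n : ℕ} (hR₁ : R₁ ≤ H₂ - H₁₂)
    (hR₂ : R₂ ≤ H₁ - H₁₂) (hR₁₂ : R₁ + R₂ ≤ H₀ - H₁₂) (hδ : 0 ≤ δ) (hM₁ : 0 < M₁)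
    (hM₂ : 0 < M₂) (h₁ : M₁ ≤ ⌈(2 : ℝ) ^ ((n : ℝ) * (R₁ - δ))⌉₊)
    (h₂ : M₂ ≤ ⌈(2 : ℝ) ^ ((n : ℝ) * (R₂ - δ))⌉₊) :
    (M₁ - 1) * ((2 : ℝ) ^ (n * (H₁₂ + η)) * (2 : ℝ) ^ (-(n * (H₂ - η)))) +
      (M₂ - 1) * ((2 : ℝ) ^ (n * (H₁₂ + η)) * (2 : ℝ) ^ (-(n * (H₁ - η)))) +
      (M₁ - 1) * (M₂ - 1) * ((2 : ℝ) ^ (n * (H₁₂ + η)) * (2 : ℝ) ^ (-(n * (H₀ - η)))) ≤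
      3 * ((2 : ℝ) ^ (-(δ - 2 * η))) ^ n := by
  have e₁ := cast_sub_one_le (by positivity) h₁
  have e₂ := cast_sub_one_le (by positivity) h₂
  have f₁ : (0 : ℝ) ≤ M₁ - 1 := sub_nonneg.mpr (by exact_mod_cast hM₁)
  have f₂ : (0 : ℝ) ≤ M₂ - 1 := sub_nonneg.mpr (by exact_mod_cast hM₂)
  have hn : (0 : ℝ) ≤ n := n.cast_nonneg
  -- One computation for all three kinds of error: `w` counts the competitors and `H` is the entropy
  -- of the flattened state.
  have key : ∀ {w s H : ℝ}, w ≤ (2 : ℝ) ^ (n * s) → s ≤ H - H₁₂ - δ →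
      w * ((2 : ℝ) ^ (n * (H₁₂ + η)) * (2 : ℝ) ^ (-(n * (H - η)))) ≤
        ((2 : ℝ) ^ (-(δ - 2 * η))) ^ n := by
    intro w s H hw hs
    calc _ ≤ (2 : ℝ) ^ (n * s) * ((2 : ℝ) ^ (n * (H₁₂ + η)) * (2 : ℝ) ^ (-(n * (H - η)))) := by
          gcongr
      _ = (2 : ℝ) ^ (n * (s + (H₁₂ + η) - (H - η))) := by
          rw [← Real.rpow_add two_pos, ← Real.rpow_add two_pos]
          congr 1
          ring
      _ ≤ (2 : ℝ) ^ (n * (-(δ - 2 * η))) := by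
          refine Real.rpow_le_rpow_of_exponent_le one_le_two ?_
          exact mul_le_mul_of_nonneg_left (by linarith) hn
      _ = _ := by rw [mul_comm, Real.rpow_mul_natCast zero_le_two]
  have k₁ := key e₁ (by linarith : R₁ - δ ≤ H₂ - H₁₂ - δ)
  have k₂ := key e₂ (by linarith : R₂ - δ ≤ H₁ - H₁₂ - δ)
  have e₃ : ((M₁ : ℝ) - 1) * (M₂ - 1) ≤ (2 : ℝ) ^ (n * ((R₁ - δ) + (R₂ - δ))) := by
    rw [mul_add, Real.rpow_add two_pos]
    exact mul_le_mul e₁ e₂ f₂ (by positivity)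
  have k₃ := key e₃ (by linarith : (R₁ - δ) + (R₂ - δ) ≤ H₀ - H₁₂ - δ)
  linarith

end ErrorBound

end QMAC

end

/-! ### Simultaneous decoding -/

theorem mainTheorem1 {X₁ X₂ b : Type*} [Fintype X₁] [DecidableEq X₁] [Fintype X₂]
    [DecidableEq X₂] [Fintype b] [DecidableEq b]
    (ρ : X₁ → X₂ → QMAC.DensityMatrix b) (p₁ : stdSimplex ℝ X₁) (p₂ : stdSimplex ℝ X₂)
    (R₁ R₂ : ℝ)
    (hR₁ : R₁ ≤ QMAC.infoOne p₁ p₂ ρ)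
    (hR₂ : R₂ ≤ QMAC.infoTwo p₁ p₂ ρ)
    (hR₁₂ : R₁ + R₂ ≤ QMAC.infoBoth p₁ p₂ ρ)
    (ε δ η : ℝ) (hε : 0 < ε) (hη : 0 < η) (hδ : 2 * η < δ) :
    ∃ N : ℕ, ∀ n : ℕ, N ≤ n → ∀ M₁ M₂ : ℕ, 0 < M₁ → 0 < M₂ →
      M₁ ≤ ⌈(2 : ℝ) ^ ((n : ℝ) * (R₁ - δ))⌉₊ → M₂ ≤ ⌈(2 : ℝ) ^ ((n : ℝ) * (R₂ - δ))⌉₊ →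
      (∀ (c₁ : Fin M₁ → Fin n → X₁) (c₂ : Fin M₂ → Fin n → X₂),
        QMAC.IsPOVM (QMAC.squareRootPOVM (QMAC.sandwich p₁ p₂ ρ η c₁ c₂))) ∧
      QMAC.codebookExpectation p₁ p₂ (fun (c₁ : Fin M₁ → Fin n → X₁) (c₂ : Fin M₂ → Fin n → X₂) =>
        QMAC.avgError ρ c₁ c₂ (QMAC.squareRootOp (QMAC.sandwich p₁ p₂ ρ η c₁ c₂))) ≤ ε ∧
      QMAC.codebookExpectation p₁ p₂ (fun (c₁ : Fin M₁ → Fin n → X₁) (c₂ : Fin M₂ → Fin n → X₂) =>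
        QMAC.avgError ρ c₁ c₂ (QMAC.squareRootPOVM (QMAC.sandwich p₁ p₂ ρ η c₁ c₂))) ≤ ε := by
  open QMAC in
  rw [infoOne_eq] at hR₁
  rw [infoTwo_eq] at hR₂
  rw [infoBoth_eq] at hR₁₂
  -- The missed detections have total weight `88 + 48 + 32 + 10 = 178` and thus use up `ε / 2`. The
  -- false ones, with factor `8 * 3 = 24` and each at most `ε / 48`, use up the other half.
  have hε' : 0 < ε / 356 := by positivity
  obtain ⟨N₁, hN₁⟩ := exists_forall_typicalProjector_average_le p₁ p₂ ρ hη hε'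
  obtain ⟨N₂, hN₂⟩ := exists_forall_projectorLeft_le p₁ p₂ ρ hη hε'
  obtain ⟨N₃, hN₃⟩ := exists_forall_projectorBoth_le p₁ p₂ ρ hη hε'
  obtain ⟨N₄, hN₄⟩ := exists_forall_projectorRight_le p₁ p₂ ρ hη hε'
  have hr1 : (2 : ℝ) ^ (-(δ - 2 * η)) < 1 :=
    Real.rpow_lt_one_of_one_lt_of_neg one_lt_two (by linarith)
  obtain ⟨N₅, hN₅⟩ := exists_pow_lt_of_lt_one (show 0 < ε / 48 by positivity) hr1
  refine ⟨max (max (max N₁ N₂) (max N₃ N₄)) (max N₅ 1), fun n hn M₁ M₂ hM₁ hM₂ h₁ h₂ => ?_⟩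
  simp only [max_le_iff] at hn
  obtain ⟨⟨⟨n₁, n₂⟩, n₃, n₄⟩, n₅, n₆⟩ := hn
  have hP : ∀ (c₁ : Fin M₁ → Fin n → X₁) (c₂ : Fin M₂ → Fin n → X₂) (m : Fin M₁ × Fin M₂),
      0 ≤ sandwich p₁ p₂ ρ η c₁ c₂ m := fun c₁ c₂ m => wordSandwich_nonneg ..
  have hpow : ((2 : ℝ) ^ (-(δ - 2 * η))) ^ n ≤ ε / 48 :=
    (pow_le_pow_of_le_one (by positivity) hr1.le n₅).trans hN₅.le
  have hrate := rate_bound η (H₁₂ := condEntropyBoth p₁ p₂ ρ) (H₁ := condEntropyLeft p₁ p₂ ρ)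
    (H₂ := condEntropyRight p₁ p₂ ρ) (H₀ := entropy (averageBoth p₁ p₂ ρ).mat)
    hR₁ hR₂ hR₁₂ (by linarith) hM₁ hM₂ h₁ h₂
  have hmsg : ∀ m : Fin M₁ × Fin M₂, codebookExpectation (n := n) p₁ p₂ (fun c₁ c₂ =>
      ((1 - squareRootOp (sandwich p₁ p₂ ρ η c₁ c₂) m) *
        outputState ρ (c₁ m.1) (c₂ m.2)).trace.re) ≤ ε := by
    intro m
    refine (codebookExpectation_mono p₁ p₂ fun c₁ c₂ =>
      trace_one_sub_squareRootOp_le p₁ p₂ ρ η c₁ c₂ m).trans ?_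
    simp only [codebookExpectation_add, codebookExpectation_const_mul, codebookExpectation_sum]
    have a₁ := hN₁ n n₁
    have a₂ := hN₂ n n₂
    have a₃ := hN₃ n n₃
    have a₄ := hN₄ n n₄
    rw [← codebookExpectation_apply p₁ p₂ m.1 m.2] at a₁ a₂ a₃ a₄
    have a₅ := sum_codebookExpectation_crossTerm_le p₁ p₂ ρ η n₆ m le_rfl le_rfl le_rfl
    linarith
  have hsq := codebookExpectation_avgError_le p₁ p₂ ρ hM₁ hM₂ _ hmsg
  refine ⟨fun c₁ c₂ => ?_, hsq, ?_⟩
  · have : Nonempty (Fin M₁ × Fin M₂) := ⟨⟨0, hM₁⟩, ⟨0, hM₂⟩⟩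
    exact isPOVM_squareRootPOVM (hP c₁ c₂)
  · refine codebookExpectation_avgError_le p₁ p₂ ρ hM₁ hM₂ _ fun m =>
      (codebookExpectation_mono p₁ p₂ fun c₁ c₂ => ?_).trans (hmsg m)
    exact trace_mul_le_trace_mul
      (sub_le_sub_left (squareRootOp_le_squareRootPOVM (hP c₁ c₂) m) 1) (outputState_nonneg ..)
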